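/- All vector spaces are over $\mathbb{Q}$. A finite quiver $Q$ with vertex set $Q_0$ is called symmetric if its incidence matrix $(m_{i,j})_{i,j\in Q_0}$, where $m_{i,j}$ is the number of arrows from $i$ to $j$, is symmetric. For a symmetric quiver $Q$, let $\mathcal{A}_Q$ be the associative unital algebra with generators $e_{i,k}$ ($i\in Q_0$, $k\ge 0$), where $e_{i,k}$ has the parity of $m_{i,i}$, subject to the following relations, imposed coefficient by coefficient on the generating series $e_i(z)=\sum_{k\ge0}e_{i,k}z^k$: \[ e_i(z)e_j(w)=(-1)^{m_{i,i}m_{j,j}}e_j(w)e_i(z)\ \text{ for all } i,j,\qquad e_i(z)\frac{d^p}{dz^p}e_j(z)=0\ \text{ for all } i,j \text{ and } 0\le p<m_{i,j}. \] An odd derivation of $\mathcal{A}_Q$ is a linear map $\partial\colon\mathcal{A}_Q\to\mathcal{A}_Q$ that reverses parity and satisfies $\partial(xy)=\partial(x)y+(-1)^{|x|}x\,\partial(y)$ for all $x$ homogeneous of parity $|x|$ and all $y$. Let $a\neq b$ be vertices of $Q$ with $m_{a,b}>0$. The unlinked quiver $Q^{\mathrm{unlinked}}$ is the symmetric quiver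 with vertex set $Q_0\sqcup\{\star\}$ whose incidence matrix is the symmetric matrix $m'$ with $m'_{a,b}=m_{a,b}-1$; $m'_{i,j}=m_{i,j}$ for all other $i,j\in Q_0$; $m'_{a,\star}=m_{a,a}+m_{a,b}-1$; $m'_{b,\star}=m_{b,b}+m_{a,b}-1$; $m'_{i,\star}=m_{i,a}+m_{i,b}$ for $i\in Q_0\setminus\{a,b\}$; and $m'_{\star,\star}=m_{a,a}+m_{b,b}+2m_{a,b}-1$. Theorem. There is a unique odd derivation $\partial$ of $\mathcal{A}_{Q^{\mathrm{unlinked}}}$ such that, coefficient by coefficient, \[ \partial(e_\star(z))=e_a(z)\frac{d^{\,m_{a,b}-1}}{dz^{\,m_{a,b}-1}}e_b(z),\qquad \partial(e_i(z))=0\ \text{ for } i\in Q_0 . \] It satisfies $\partial^2=0$, and its homology $H_\bullet(\mathcal{A}_{Q^{\mathrm{unlinked}}},\partial)=\ker\partial/\operatorname{im}\partial$, with the induced algebra structure, is isomorphic to $\mathcal{A}_Q$ as an algebra, by an isomorphism that sends the class of $e_{i,k}$ to $e_{i,k}$ for all $i\in Q_0$, $k\ge 0$. -/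

import Mathlib

open scoped PowerSeries

universe u v

namespace SymmQuiver

noncomputable section

/-! ### Quivers, incidence matrices and unlinking -/

/-- The incidence matrix: `m i j` is the number of arrows from `i` to `j`. -/
def incidenceMatrix (V : Type u) [Quiver.{v} V] : Matrix V V ℕ :=
  Matrix.of fun i j => Nat.card (i ⟶ j)

/-- A quiver is symmetric if there are as many arrows `i ⟶ j` as arrows `j ⟶ i`, for all `i, j`. -/
def IsSymmetric (V : Type u) [Quiver.{v} V] : Prop :=
  (incidenceMatrix V).IsSymm

/-- The vertices of the unlinked quiver: those of `V` together with one new vertex `star`. -/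
inductive Unlinked (V : Type u) (a b : V) : Type u
  | vertex (i : V) : Unlinked V a b
  | star : Unlinked V a b

open Classical in
/-- The incidence matrix of the unlinked quiver, for a matrix `m` over `V` and two vertices
`a ≠ b` with `0 < m a b` (so that none of the subtractions truncates). -/
def unlinkedMatrix {V : Type u} (m : Matrix V V ℕ) (a b : V) :
    Matrix (Unlinked V a b) (Unlinked V a b) ℕ
  | .vertex i, .vertex j =>
      if (i = a ∧ j = b) ∨ (i = b ∧ j = a) then m i j - 1 else m i j
  | .vertex i, .star =>
      if i = a then m a a + m a b - 1
      else if i = b then m b b + m a b - 1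
      else m i a + m i b
  | .star, .vertex j =>
      if j = a then m a a + m a b - 1
      else if j = b then m b b + m a b - 1
      else m j a + m j b
  | .star, .star => m a a + m b b + 2 * m a b - 1

/-- The unlinked quiver: the quiver on `V ⊔ {star}` whose incidence matrix is `unlinkedMatrix`. -/
instance Unlinked.quiver (V : Type u) [Quiver.{v} V] (a b : V) :
    Quiver.{0} (Unlinked V a b) where
  Hom i j := Fin (unlinkedMatrix (incidenceMatrix V) a b i j)

theorem incidenceMatrix_unlinked (V : Type u) [Quiver.{v} V] (a b : V) :
    incidenceMatrix (Unlinked V a b) = unlinkedMatrix (incidenceMatrix V) a b := by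
  ext i j
  exact Nat.card_fin _

/-! ### Formal power series with coefficients in a possibly noncommutative ring -/

/-- The formal derivative `d/dz` of a power series. -/
def derivSeries {R : Type*} [Semiring R] (f : R⟦X⟧) : R⟦X⟧ :=
  PowerSeries.mk fun n => ((n : R) + 1) * PowerSeries.coeff (n + 1) f

/-- The series `x(z) * (d/dz)^p y(z)`, where `x(z) = ∑ x k z^k` and `y(z) = ∑ y k z^k`. -/
def mulDeriv {R : Type*} [Semiring R] (x y : ℕ → R) (p : ℕ) : R⟦X⟧ :=
  PowerSeries.mk x * derivSeries^[p] (PowerSeries.mk y)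

/-! ### The supercommutative quadratic algebra of a quiver -/

/-- The free generators `e i k` with `i` a vertex and `k ≥ 0`. -/
abbrev freeGen (V : Type u) (i : V) (k : ℕ) : FreeAlgebra ℚ (V × ℕ) :=
  FreeAlgebra.ι ℚ (i, k)

/-- The defining relations: supercommutativity of the generators, where `e i k` has the parity of
`m i i`, and the vanishing of all coefficients of `e_i(z) * (d/dz)^p e_j(z)` for `p < m i j`. -/
inductive Rel (V : Type u) [Quiver.{v} V] :
    FreeAlgebra ℚ (V × ℕ) → FreeAlgebra ℚ (V × ℕ) → Prop
  | supercomm (i j : V) (k l : ℕ) :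
      Rel V (freeGen V i k * freeGen V j l)
        ((-1 : ℚ) ^ (incidenceMatrix V i i * incidenceMatrix V j j) •
          (freeGen V j l * freeGen V i k))
  | quadratic (i j : V) (p n : ℕ) (hp : p < incidenceMatrix V i j) :
      Rel V (PowerSeries.coeff n (mulDeriv (freeGen V i) (freeGen V j) p)) 0

/-- The algebra `A_Q` of the quiver `Q` with vertex set `V`. -/
def QAlg (V : Type u) [Quiver.{v} V] : Type u := RingQuot (Rel V)

instance (V : Type u) [Quiver.{v} V] : Ring (QAlg V) := inferInstanceAs (Ring (RingQuot (Rel V)))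

instance (V : Type u) [Quiver.{v} V] : Algebra ℚ (QAlg V) :=
  inferInstanceAs (Algebra ℚ (RingQuot (Rel V)))

/-- The projection from the free algebra onto `A_Q`. -/
def proj (V : Type u) [Quiver.{v} V] : FreeAlgebra ℚ (V × ℕ) →ₐ[ℚ] QAlg V :=
  RingQuot.mkAlgHom ℚ (Rel V)

theorem proj_rel (V : Type u) [Quiver.{v} V] {x y : FreeAlgebra ℚ (V × ℕ)} (h : Rel V x y) :
    proj V x = proj V y :=
  RingQuot.mkAlgHom_rel ℚ h

/-- The generator `e_{i,k}` of `A_Q`. -/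
def gen (V : Type u) [Quiver.{v} V] (i : V) (k : ℕ) : QAlg V :=
  proj V (freeGen V i k)

section Parity

variable (V : Type u) [Quiver.{v} V]

/-- The automorphism of the free algebra that multiplies `e i k` by `(-1) ^ m i i`. -/
def freeParity : FreeAlgebra ℚ (V × ℕ) →ₐ[ℚ] FreeAlgebra ℚ (V × ℕ) :=
  FreeAlgebra.lift ℚ fun g => (-1 : ℚ) ^ incidenceMatrix V g.1 g.1 • freeGen V g.1 g.2

theorem coeff_iterate_derivSeries_smul {R : Type*} [Ring R] [Algebra ℚ R] (c : ℚ) (p n : ℕ)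
    (f g : R⟦X⟧) (h : ∀ n, PowerSeries.coeff n f = c • PowerSeries.coeff n g) :
    PowerSeries.coeff n (derivSeries^[p] f) = c • PowerSeries.coeff n (derivSeries^[p] g) := by
  induction p generalizing n f g with
  | zero => exact h n
  | succ p ih =>
    rw [Function.iterate_succ_apply, Function.iterate_succ_apply]
    refine ih n _ _ fun k => ?_
    simp [derivSeries, h]

theorem map_coeff_mulDeriv {R S : Type*} [Ring R] [Ring S] [Algebra ℚ R] [Algebra ℚ S]
    (φ : R →ₐ[ℚ] S) (x y : ℕ → R) (x' y' : ℕ → S) (c d : ℚ) (hx : ∀ k, φ (x k) = c • x' k)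
    (hy : ∀ k, φ (y k) = d • y' k) (p n : ℕ) :
    φ (PowerSeries.coeff n (mulDeriv x y p)) =
      (c * d) • PowerSeries.coeff n (mulDeriv x' y' p) := by
  have key : ∀ (q k : ℕ) (f : R⟦X⟧),
      φ (PowerSeries.coeff k (derivSeries^[q] f)) =
        PowerSeries.coeff k (derivSeries^[q] (PowerSeries.map (φ : R →+* S) f)) := by
    intro q
    induction q with
    | zero => intro k f; simp
    | succ q ih =>
      intro k f
      rw [Function.iterate_succ_apply, Function.iterate_succ_apply, ih]
      congr 2
      ext j
      simp [derivSeries]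
  have h2 : ∀ k, φ (PowerSeries.coeff k (derivSeries^[p] (PowerSeries.mk y))) =
      d • PowerSeries.coeff k (derivSeries^[p] (PowerSeries.mk y')) := by
    intro k
    rw [key]
    refine coeff_iterate_derivSeries_smul d p k _ _ fun j => ?_
    simp [hy]
  simp only [mulDeriv, PowerSeries.coeff_mul, map_sum, map_mul, h2, PowerSeries.coeff_mk, hx,
    Finset.smul_sum, smul_mul_smul_comm]

theorem freeParity_freeGen (i : V) (k : ℕ) :
    freeParity V (freeGen V i k) = (-1 : ℚ) ^ incidenceMatrix V i i • freeGen V i k := by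
  simp [freeParity, freeGen]

theorem freeParity_rel ⦃x y : FreeAlgebra ℚ (V × ℕ)⦄ (h : Rel V x y) :
    (proj V).comp (freeParity V) x =
      (proj V).comp (freeParity V) y := by
  induction h with
  | supercomm i j k l =>
    have h := proj_rel V (Rel.supercomm i j k l)
    simp only [map_mul, map_smul] at h
    simp only [AlgHom.comp_apply, map_mul, map_smul, freeParity_freeGen, smul_mul_smul_comm, h]
    rw [smul_comm, mul_comm ((-1 : ℚ) ^ incidenceMatrix V i i)]
  | quadratic i j p n hp =>
    have h := proj_rel V (Rel.quadratic i j p n hp)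
    rw [AlgHom.comp_apply, map_coeff_mulDeriv (freeParity V) _ _ _ _ _ _
      (freeParity_freeGen V i) (freeParity_freeGen V j), map_smul, h]
    simp

/-- The parity automorphism of `A_Q`: it multiplies the generator `e_{i,k}`, whose homological
degree is `- 2 k - m i i`, by `(-1) ^ m i i`. -/
def parity : QAlg V →ₐ[ℚ] QAlg V :=
  RingQuot.liftAlgHom ℚ ⟨(proj V).comp (freeParity V), freeParity_rel V⟩

theorem parity_gen (i : V) (k : ℕ) :
    parity V (gen V i k) = (-1 : ℚ) ^ incidenceMatrix V i i • gen V i k := by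
  refine (RingQuot.liftAlgHom_mkAlgHom_apply ℚ _ (freeParity_rel V) _).trans ?_
  rw [AlgHom.comp_apply, freeParity_freeGen, map_smul, gen]

theorem parity_parity (x : QAlg V) : parity V (parity V x) = x := by
  have h : (parity V).comp (parity V) = AlgHom.id ℚ (QAlg V) := by
    refine RingQuot.ringQuot_ext' ℚ _ _ (FreeAlgebra.hom_ext ?_)
    funext ⟨i, k⟩
    change parity V (parity V (gen V i k)) = gen V i k
    rw [parity_gen, map_smul, parity_gen, smul_smul, ← mul_pow]
    simp
  exact DFunLike.congr_fun h x

/-- The elements of `A_Q` of parity `p`: even elements for even `p`, odd ones for odd `p`. -/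
def parityPart (p : ℕ) : Submodule ℚ (QAlg V) where
  carrier := {x | parity V x = (-1 : ℚ) ^ p • x}
  add_mem' {x y} hx hy := by
    simp only [Set.mem_ofPred_eq] at *
    rw [map_add, hx, hy, smul_add]
  zero_mem' := by simp
  smul_mem' c x hx := by
    simp only [Set.mem_ofPred_eq] at *
    rw [map_smul, hx, smul_comm]

/-- An odd derivation of the superalgebra `A_Q`: a linear map that reverses parity and satisfies
the Leibniz rule with the Koszul sign. -/
structure IsOddDerivation (D : QAlg V →ₗ[ℚ] QAlg V) : Prop where
  odd : ∀ (p : ℕ) (x : QAlg V), x ∈ parityPart V p → D x ∈ parityPart V (p + 1)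
  leibniz : ∀ (p : ℕ) (x y : QAlg V), x ∈ parityPart V p →
    D (x * y) = D x * y + (-1 : ℚ) ^ p • (x * D y)

variable {V}

theorem exists_even_odd (x : QAlg V) :
    ∃ y ∈ parityPart V 0, ∃ z ∈ parityPart V 1, x = y + z ∧ parity V x = y - z := by
  refine ⟨(1 / 2 : ℚ) • (x + parity V x), ?_, (1 / 2 : ℚ) • (x - parity V x), ?_, ?_, ?_⟩
  · change parity V _ = _
    rw [map_smul, map_add, parity_parity, add_comm, pow_zero, one_smul]
  · change parity V _ = _
    rw [map_smul, map_sub, parity_parity, pow_one, neg_one_smul, ← smul_neg, neg_sub]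
  · rw [← smul_add, add_add_sub_cancel, ← two_smul ℚ x, smul_smul]
    norm_num
  · rw [← smul_sub, add_sub_sub_cancel, ← two_smul ℚ (parity V x), smul_smul]
    norm_num

variable {D : QAlg V →ₗ[ℚ] QAlg V}

theorem IsOddDerivation.parity_comm (hD : IsOddDerivation V D) (x : QAlg V) :
    parity V (D x) = -D (parity V x) := by
  obtain ⟨y, hy, z, hz, hx, hp⟩ := exists_even_odd x
  have h1 : parity V (D y) = _ := hD.odd 0 y hy
  have h2 : parity V (D z) = _ := hD.odd 1 z hz
  rw [hp, hx, map_add, map_add, map_sub, h1, h2]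
  norm_num
  abel

theorem IsOddDerivation.leibniz_parity (hD : IsOddDerivation V D) (x y : QAlg V) :
    D (x * y) = D x * y + parity V x * D y := by
  obtain ⟨s, hs, t, ht, hx, hp⟩ := exists_even_odd x
  rw [hp, hx, add_mul, map_add, map_add, hD.leibniz 0 s y hs, hD.leibniz 1 t y ht]
  rw [pow_zero, pow_one, one_smul, neg_one_smul, add_mul, sub_mul]
  abel

theorem IsOddDerivation.map_one (hD : IsOddDerivation V D) : D 1 = 0 := by
  simpa using hD.leibniz_parity 1 1

end Parity

/-! ### Homology of an odd square-zero derivation -/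

section Homology

variable {V : Type u} [Quiver.{v} V] {D : QAlg V →ₗ[ℚ] QAlg V}

/-- The cycles: the kernel of an odd derivation, a subalgebra. -/
def cycles (hD : IsOddDerivation V D) : Subalgebra ℚ (QAlg V) where
  carrier := {x | D x = 0}
  mul_mem' {x y} hx hy := by
    simp only [Set.mem_ofPred_eq] at *
    rw [hD.leibniz_parity, hx, hy, zero_mul, mul_zero, add_zero]
  add_mem' {x y} hx hy := by
    simp only [Set.mem_ofPred_eq] at *
    rw [map_add, hx, hy, add_zero]
  algebraMap_mem' r := by
    simp only [Set.mem_ofPred_eq]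
    rw [Algebra.algebraMap_eq_smul_one, map_smul, hD.map_one, smul_zero]

/-- The boundaries, as an ideal of the algebra of cycles. Here `D ∘ D = 0`, so every element of
the range of `D` is a cycle. -/
def boundaries (hD : IsOddDerivation V D) (_hsq : ∀ x, D (D x) = 0) : Ideal (cycles hD) where
  carrier := {x | ∃ w, D w = (x : QAlg V)}
  add_mem' := by
    rintro x y ⟨v, hv⟩ ⟨w, hw⟩
    exact ⟨v + w, by rw [map_add, hv, hw]; rfl⟩
  zero_mem' := ⟨0, by simp⟩
  smul_mem' := by
    rintro ⟨c, hc⟩ x ⟨w, hw⟩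
    have hc' : D c = 0 := hc
    refine ⟨parity V c * w, ?_⟩
    have h : D (parity V c) = 0 := by
      rw [← neg_eq_zero, ← hD.parity_comm, hc', map_zero]
    rw [hD.leibniz_parity, h, parity_parity, zero_mul, zero_add, hw]
    rfl

instance boundaries_isTwoSided (hD : IsOddDerivation V D) (hsq : ∀ x, D (D x) = 0) :
    (boundaries hD hsq).IsTwoSided where
  mul_mem_of_left := by
    rintro x ⟨c, hc⟩ ⟨w, hw⟩
    have hc' : D c = 0 := hc
    refine ⟨w * c, ?_⟩
    rw [hD.leibniz_parity, hc', mul_zero, add_zero, hw]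
    rfl

/-- The homology algebra `ker D / im D`. -/
abbrev Homology (hD : IsOddDerivation V D) (hsq : ∀ x, D (D x) = 0) : Type u :=
  cycles hD ⧸ boundaries hD hsq

/-- The homology class of a cycle. -/
def homologyClass (hD : IsOddDerivation V D) (hsq : ∀ x, D (D x) = 0) (x : QAlg V)
    (hx : D x = 0) : Homology hD hsq :=
  Ideal.Quotient.mk (boundaries hD hsq) ⟨x, hx⟩

end Homology

/-- The linear map `D` on the algebra of the unlinked quiver takes the prescribed values on the
generators: `D e_⋆(z) = e_a(z) * (d/dz)^(m_ab - 1) e_b(z)`, coefficient by coefficient, and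
`D e_i(z) = 0` for every old vertex `i`. -/
structure IsUnlinkingOnGenerators (V : Type u) [Quiver.{v} V] (a b : V)
    (D : QAlg (Unlinked V a b) →ₗ[ℚ] QAlg (Unlinked V a b)) : Prop where
  star : ∀ k : ℕ, D (gen (Unlinked V a b) .star k) =
    PowerSeries.coeff k (mulDeriv (gen (Unlinked V a b) (.vertex a))
      (gen (Unlinked V a b) (.vertex b)) (incidenceMatrix V a b - 1))
  vertex : ∀ (i : V) (k : ℕ), D (gen (Unlinked V a b) (.vertex i) k) = 0

end

end SymmQuiver

/-!
Let `Q'` be the unlinked quiver. For every symmetric quiver, the generators `e_{c,0}` are controlled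
by endomorphisms `e_j(z) ↦ z^(s_j) e_j(z)` of the algebra (`shift`), which exist because powers of
`z` do not change the order to which `e_i(z) e_j(w)` vanishes on the diagonal:

* the kernel of `e_c(z) ↦ z e_c(z)` is the ideal generated by `e_{c,0}` (`exists_eq_gen_mul`), since
  a homomorphism that kills `e_{c,0}` factors through this shift after division by `z`;
* the annihilator of `e_{c,0}` is the kernel of the shift by the row of `c` in the incidence matrix
  (`gen_zero_mul_eq_zero_iff`).

The second statement rests on a faithful model. The algebra acts on the polynomial ring in commuting
variables `x_{j,k}` by vertex operators with `E_i(z) E_j(w) = ± (z - w)^(m_ij) : E_i(z) E_j(w) :`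
(`vertexRep`), where `e_{c,0}` acts as a shift followed by multiplication by `x_{c,0}`, and
`x ↦ x · 1` is injective (`toFock_injective`).

The differential is constructed as a homomorphism to upper triangular 2×2 matrices, whose diagonal
entries are the parity automorphism and the identity. The relations hold because the series
`c(z) = e_a(z) (d/dz)^(m_ab - 1) e_b(z)` behaves as a generating series: `e_i(w) c(z)` vanishes on
the diagonal to the order `m'_ia + m'_ib` (`vanish_genSeries_collision`).

The projection `A_{Q'} → A_Q` that kills the generators of `star` kills all boundaries, and there is
a homomorphism from `A_Q` to the homology (`toHomology`). The main point is that a cycle `x` over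
zero in `A_Q` is a boundary (`exists_diff_eq`). This is proved by induction on the number of
generators of `a` and `star`. The joint shift of `a` and `star` commutes with the differential, is
surjective and is locally nilpotent in positive degree. A second induction therefore reduces the
claim to cycles that it kills, which have the form `e_{star,0} v + e_{a,0} u`. The equation `D x = 0` says
that a shift of `v` is a cycle; that it lies over zero is seen from the part of the equation without
generators of `star`, because the rows of the incidence matrices satisfy `incidenceMatrix_add_row`.
By induction the shift of `v` is a boundary, and so `e_{star,0} v` can be removed. The annihilator
of `e_{a,0}` gives the same argument for the remaining term `e_{a,0} u`. Cycles over zero without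
generators of `star` are boundaries because the only new relations of `A_Q` are the coefficients of
`c(z)` (`exists_diff_eq_degZero`).
-/

namespace SymmQuiver

/-! ### Orders of vanishing in a differential ring -/

section Calculus

/-- The product `x(z) y(w)` vanishes to order at least `n` on the diagonal `z = w`, expressed
through a derivation `δ` (the derivative in `z`): `x * δ^p y = 0` for all `p < n`. -/
def Vanish {B : Type*} [Ring B] (δ : B →+ B) (x y : B) (n : ℕ) : Prop :=
  ∀ p < n, x * δ^[p] y = 0

variable {B : Type*} [Ring B] {δ : B →+ B} (hδ : ∀ x y, δ (x * y) = δ x * y + x * δ y)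
include hδ

theorem Vanish.iterate_mul_iterate_eq_zero {x y : B} {n : ℕ} (h : Vanish δ x y n) (k l : ℕ)
    (hkl : k + l < n) : δ^[k] x * δ^[l] y = 0 := by
  induction k generalizing l with
  | zero => exact h l (by omega)
  | succ k ih =>
    have h1 := ih l (by omega)
    have h2 := hδ (δ^[k] x) (δ^[l] y)
    rw [h1, map_zero, ← Function.iterate_succ_apply' δ, ← Function.iterate_succ_apply' δ,
      ih (l + 1) (by omega), add_zero] at h2
    exact h2.symm

/-- At the order of vanishing, a derivative can be moved from one factor to the other, at the
price of a sign. -/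
theorem Vanish.iterate_mul_iterate {x y : B} {n : ℕ} (h : Vanish δ x y n) (k l : ℕ)
    (hkl : k + l = n) : δ^[k] x * δ^[l] y = (-1) ^ k * (x * δ^[n] y) := by
  induction k generalizing l with
  | zero => simp [← hkl]
  | succ k ih =>
    have h1 := h.iterate_mul_iterate_eq_zero hδ k l (by omega)
    have h2 := hδ (δ^[k] x) (δ^[l] y)
    rw [h1, map_zero, ← Function.iterate_succ_apply' δ, ← Function.iterate_succ_apply' δ,
      ih (l + 1) (by omega)] at h2
    rw [pow_succ, mul_neg_one, neg_mul]
    exact eq_neg_of_add_eq_zero_left h2.symm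

/-- The Leibniz formula. -/
theorem iterate_mul (n : ℕ) (x y : B) :
    δ^[n] (x * y) = ∑ r ∈ Finset.range (n + 1), n.choose r • (δ^[r] x * δ^[n - r] y) := by
  rw [← Finset.Nat.sum_antidiagonal_eq_sum_range_succ
    (fun i j => n.choose i • (δ^[i] x * δ^[j] y))]
  induction n with
  | zero => simp
  | succ n ih =>
    rw [Function.iterate_succ_apply', ih, map_sum,
      Finset.sum_antidiagonal_choose_succ_nsmul (fun i j => δ^[i] x * δ^[j] y),
      ← Finset.sum_add_distrib]
    refine Finset.sum_congr rfl fun ij hij => ?_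
    rw [map_nsmul, hδ, smul_add, ← Function.iterate_succ_apply' δ,
      ← Function.iterate_succ_apply' δ, add_comm, ← Nat.choose_symm_of_eq_add
        (Finset.HasAntidiagonal.mem_antidiagonal.mp hij).symm]

omit hδ in
/-- A family `g 0, …, g N` that is orthogonal to all polynomials of degree `< μ` and supported on
at most `μ` points is zero. The first property is tested on falling factorials. -/
theorem eq_zero_of_descFactorial_sum {M : Type*} [AddCommGroup M] [Module ℚ M] {N α β μ : ℕ}
    (hN : N < α + β + μ) (g : ℕ → M) (h1 : ∀ r < α, g r = 0) (h2 : ∀ r ≤ N, N - r < β → g r = 0)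
    (h3 : ∀ q < μ, ∑ r ∈ Finset.range (N + 1), ((N - r).descFactorial q : ℚ) • g r = 0)
    (r : ℕ) (hr : r ≤ N) : g r = 0 := by
  have key : ∀ (L : Finset ℕ) (q : ℕ), q + L.card < μ → ∑ r ∈ Finset.range (N + 1),
      (((N - r).descFactorial q : ℚ) * ∏ c ∈ L, (((N - r : ℕ) : ℚ) - c)) • g r = 0 := by
    intro L
    induction L using Finset.induction_on with
    | empty => intro q hq; simpa using h3 q (by simpa using hq)
    | insert c L hc ih =>
      intro q hq
      rw [Finset.card_insert_of_notMem hc] at hq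
      -- `t ^ (q) * (t - c) = t ^ (q + 1) + (q - c) * t ^ (q)` for falling factorials
      have e : ∀ t : ℕ, (t.descFactorial q : ℚ) * (t - c) =
          t.descFactorial (q + 1) + (q - c : ℚ) * t.descFactorial q := by
        intro t
        rw [Nat.descFactorial_succ]
        rcases le_or_gt q t with h | h
        · push_cast [h]; ring
        · simp [Nat.descFactorial_of_lt h]
      have := congrArg₂ (· + (q - c : ℚ) • ·) (ih (q + 1) (by omega)) (ih q (by omega))
      simp only [Finset.smul_sum, ← Finset.sum_add_distrib, smul_zero, add_zero] at this
      rw [← this]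
      refine Finset.sum_congr rfl fun r _ => ?_
      rw [Finset.prod_insert hc, ← mul_assoc, e, smul_smul, ← add_smul]
      ring_nf
  by_contra hne
  have hα : α ≤ r := not_lt.mp fun h => hne (h1 r h)
  have hβ : β ≤ N - r := not_lt.mp fun h => hne (h2 r hr h)
  have := key ((Finset.Icc β (N - α)).erase (N - r)) 0 (by
    rw [Finset.card_erase_of_mem (Finset.mem_Icc.mpr ⟨hβ, by omega⟩), Nat.card_Icc]
    omega)
  rw [Finset.sum_eq_single_of_mem r (Finset.mem_range.mpr (by omega))] at this
  · rcases smul_eq_zero.mp this with h | h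
    · simp only [Nat.descFactorial_zero, Nat.cast_one, one_mul, Finset.prod_eq_zero_iff] at h
      obtain ⟨c, hc, h⟩ := h
      rw [sub_eq_zero, Nat.cast_inj] at h
      exact (Finset.mem_erase.mp hc).1 h.symm
    · exact hne h
  · intro r' hr' hrr
    rw [Finset.mem_range] at hr'
    by_cases h : α ≤ r' ∧ β ≤ N - r'
    · rw [Finset.prod_eq_zero (i := N - r'), mul_zero, zero_smul]
      · exact Finset.mem_erase.mpr ⟨by omega, Finset.mem_Icc.mpr ⟨h.2, by omega⟩⟩
      · exact sub_self _
    · rw [show g r' = 0 from (not_and_or.mp h).elim (fun h => h1 r' (by omega))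
        fun h => h2 r' (by omega) (by omega), smul_zero]

/-- If `e(w) x(z)`, `e(w) y(z)` and `x(z) y(z')` vanish to the orders `α`, `β`, `μ` on the
diagonal, then `e(w) c(z)` with `c = x * δ^μ y` vanishes to the order `α + β`: a polynomial in
three variables that is divisible by `(w - z)^α (w - z')^β (z - z')^μ` has no terms of degree
less than `α + β + μ`. -/
theorem Vanish.mul_iterate [Algebra ℚ B] {e x y : B} {α β μ : ℕ} (h1 : Vanish δ e x α)
    (h2 : Vanish δ e y β) (h3 : Vanish δ x y μ) (hc : ∀ r, ∃ t, e * δ^[r] x = t * e) :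
    Vanish δ e (x * δ^[μ] y) (α + β) := by
  have key : ∀ N < α + β + μ, ∀ r ≤ N, e * (δ^[r] x * δ^[N - r] y) = 0 := by
    intro N hN r hr
    have := eq_zero_of_descFactorial_sum hN
      (fun r => (N.choose r : ℚ) • (e * (δ^[r] x * δ^[N - r] y))) ?_ ?_ ?_ r hr
    · refine (smul_eq_zero.mp this).resolve_left ?_
      exact_mod_cast (Nat.choose_pos hr).ne'
    · intro r hr
      rw [← mul_assoc, h1 r hr, zero_mul, smul_zero]
    · intro r _ hr
      obtain ⟨t, ht⟩ := hc r
      rw [← mul_assoc, ht, mul_assoc, h2 _ hr, mul_zero, smul_zero]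
    · intro q hq
      rcases lt_or_ge N q with hNq | hNq
      · refine Finset.sum_eq_zero fun r _ => ?_
        rw [Nat.descFactorial_of_lt (by omega), Nat.cast_zero, zero_smul]
      have h := congrArg (fun s => (N.descFactorial q : ℚ) • (e * δ^[N - q] s)) (h3 q hq)
      simp only [iterate_map_zero, mul_zero, smul_zero] at h
      rw [iterate_mul hδ, Finset.mul_sum, Finset.smul_sum] at h
      rw [← h]
      symm
      refine Finset.sum_subset_zero_on_sdiff (Finset.range_subset_range.mpr (by omega)) ?_ ?_
      · intro r hr
        simp only [Finset.mem_sdiff, Finset.mem_range] at hr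
        rw [Nat.descFactorial_of_lt (by omega), Nat.cast_zero, zero_smul]
      · intro r hr
        rw [Finset.mem_range] at hr
        rw [← Function.iterate_add_apply, mul_smul_comm, ← Nat.cast_smul_eq_nsmul ℚ, smul_smul,
          smul_smul, show N - q - r + q = N - r by omega]
        congr 1
        norm_cast
        have a1 := Nat.descFactorial_eq_factorial_mul_choose N q
        have a2 := Nat.descFactorial_eq_factorial_mul_choose (N - r) q
        have a3 := Nat.choose_mul (n := N) (k := N - r) (s := q) (by omega)
        rw [a1, a2]
        have a4 : N.choose r = N.choose (N - r) := (Nat.choose_symm (by omega)).symm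
        have a5 : (N - q).choose r = (N - q).choose (N - r - q) := by
          rw [← Nat.choose_symm (by omega : r ≤ N - q)]; congr 1; omega
        rw [a4, a5, mul_assoc, ← a3]
        ring
  intro p hp
  rw [iterate_mul hδ, Finset.mul_sum]
  refine Finset.sum_eq_zero fun r hr => ?_
  rw [Finset.mem_range] at hr
  rw [← Function.iterate_add_apply, mul_smul_comm, show p - r + μ = p + μ - r by omega,
    key _ (by omega) _ (by omega), smul_zero]

/-- Multiplication of the second factor by a central coordinate `t` with `δ t = 1`. -/
theorem iterate_coord_mul {t : B} (ht : δ t = 1) (p : ℕ) (y : B) :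
    δ^[p + 1] (t * y) = t * δ^[p + 1] y + (p + 1 : ℕ) • δ^[p] y := by
  induction p generalizing y with
  | zero => simp [hδ, ht, add_comm]
  | succ p ih =>
    rw [Function.iterate_succ_apply', ih, map_add, hδ, map_nsmul, ht, one_mul,
      ← Function.iterate_succ_apply' δ, ← Function.iterate_succ_apply' δ]
    rw [succ_nsmul _ (p + 1), succ_nsmul _ p]
    abel

theorem Vanish.mul_iterate_coord_mul {t : B} (ht : δ t = 1) (hc : ∀ x, x * t = t * x)
    {x y : B} {n : ℕ} (h : Vanish δ x y n) (p : ℕ) (hp : p ≤ n) :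
    x * δ^[p] (t * y) = t * (x * δ^[p] y) := by
  rcases p with _ | p
  · simp [← mul_assoc, hc]
  · rw [iterate_coord_mul hδ ht, mul_add, ← mul_assoc, hc, mul_smul_comm, h p (by omega),
      smul_zero, add_zero, mul_assoc]

/-- Up to the order of vanishing, a power of a central coordinate in the second factor commutes
with the derivatives. -/
theorem Vanish.mul_iterate_coord_pow_mul {t : B} (ht : δ t = 1) (hc : ∀ x, x * t = t * x)
    {x y : B} {n : ℕ} (h : Vanish δ x y n) (s p : ℕ) (hp : p ≤ n) :
    x * δ^[p] (t ^ s * y) = t ^ s * (x * δ^[p] y) := by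
  induction s generalizing p with
  | zero => simp
  | succ s ih =>
    have h' : Vanish δ x (t ^ s * y) n := fun q hq => by
      rw [ih q hq.le, h q hq, mul_zero]
    rw [pow_succ', mul_assoc, h'.mul_iterate_coord_mul hδ ht hc p hp, ih p hp, mul_assoc]

/-- The order of vanishing does not change on division by powers of a central coordinate. -/
theorem Vanish.of_coord_pow_mul {t : B} (ht : δ t = 1) (hc : ∀ x, x * t = t * x)
    (hinj : ∀ x, t * x = 0 → x = 0)
    {x y : B} {n r s : ℕ} (h : Vanish δ (t ^ r * x) (t ^ s * y) n) : Vanish δ x y n := by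
  have hinj' : ∀ k x, t ^ k * x = 0 → x = 0 := by
    intro k
    induction k with
    | zero => simp
    | succ k ih => intro x hx; rw [pow_succ', mul_assoc] at hx; exact ih x (hinj _ hx)
  intro p hp
  induction p using Nat.strong_induction_on with
  | _ p ih =>
    have hv : Vanish δ x y p := fun q hq => ih q hq (hq.trans hp)
    have h1 := h p hp
    rw [mul_assoc, hv.mul_iterate_coord_pow_mul hδ ht hc s p le_rfl] at h1
    exact hinj' _ _ (hinj' _ _ h1)

end Calculus

/-! ### Formal power series with the derivative -/

section Series

theorem iterate_map_rat_smul' {B : Type*} [Ring B] [Algebra ℚ B] (δ : B →+ B) (c : ℚ) (p : ℕ)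
    (x : B) : δ^[p] (c • x) = c • δ^[p] x := by
  induction p generalizing x with
  | zero => rfl
  | succ p ih => rw [Function.iterate_succ_apply, map_rat_smul, ih, Function.iterate_succ_apply]

theorem Vanish.smul {B : Type*} [Ring B] [Algebra ℚ B] {δ : B →+ B} {x y : B} {n : ℕ}
    (h : Vanish δ x y n) (c d : ℚ) : Vanish δ (c • x) (d • y) n := fun p hp => by
  rw [iterate_map_rat_smul', smul_mul_smul_comm, h p hp, smul_zero]

theorem Vanish.mono {B : Type*} [Ring B] {δ : B →+ B} {x y : B} {m n : ℕ}
    (h : Vanish δ x y n) (hmn : m ≤ n) : Vanish δ x y m := fun p hp => h p (hp.trans_le hmn)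

variable (R : Type*) [Ring R]

/-- The formal derivative of power series as an additive map. -/
noncomputable def derivHom : R⟦X⟧ →+ R⟦X⟧ where
  toFun := derivSeries
  map_zero' := by ext; simp [derivSeries]
  map_add' f g := by ext; simp [derivSeries, mul_add]

variable {R}

theorem coeff_derivHom (n : ℕ) (f : R⟦X⟧) :
    PowerSeries.coeff n (derivHom R f) = ((n : R) + 1) * PowerSeries.coeff (n + 1) f :=
  PowerSeries.coeff_mk n fun n => ((n : R) + 1) * PowerSeries.coeff (n + 1) f

theorem derivHom_mul (f g : R⟦X⟧) : derivHom R (f * g) = derivHom R f * g + f * derivHom R g := by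
  ext n
  rw [coeff_derivHom, map_add, PowerSeries.coeff_mul, PowerSeries.coeff_mul,
    PowerSeries.coeff_mul]
  have h1 : ((n : R) + 1) * ∑ p ∈ Finset.HasAntidiagonal.antidiagonal (n + 1),
        PowerSeries.coeff p.1 f * PowerSeries.coeff p.2 g =
      ∑ p ∈ Finset.HasAntidiagonal.antidiagonal (n + 1),
        ((p.1 : R) * PowerSeries.coeff p.1 f * PowerSeries.coeff p.2 g +
          PowerSeries.coeff p.1 f * ((p.2 : R) * PowerSeries.coeff p.2 g)) := by
    rw [Finset.mul_sum]
    refine Finset.sum_congr rfl fun p hp => ?_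
    rw [Finset.HasAntidiagonal.mem_antidiagonal] at hp
    rw [← mul_assoc (PowerSeries.coeff p.1 f), ← (Nat.cast_commute p.2 _).eq, ← add_mul,
      ← add_mul, ← mul_assoc]
    norm_cast
    rw [hp]
  rw [h1, Finset.sum_add_distrib, Finset.Nat.sum_antidiagonal_succ,
    Finset.Nat.sum_antidiagonal_succ']
  simp [coeff_derivHom]

theorem derivHom_X : derivHom R PowerSeries.X = 1 := by
  ext n
  rw [coeff_derivHom, PowerSeries.coeff_X, PowerSeries.coeff_one]
  rcases n with _ | n <;> simp

theorem mulDeriv_eq (x y : ℕ → R) (p : ℕ) :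
    mulDeriv x y p = PowerSeries.mk x * (derivHom R)^[p] (PowerSeries.mk y) := rfl

theorem map_iterate_derivHom {S : Type*} [Ring S] (φ : R →+* S) (p : ℕ) (f : R⟦X⟧) :
    PowerSeries.map φ ((derivHom R)^[p] f) = (derivHom S)^[p] (PowerSeries.map φ f) := by
  induction p generalizing f with
  | zero => rfl
  | succ p ih =>
    rw [Function.iterate_succ_apply, Function.iterate_succ_apply, ih]
    congr 1
    ext n
    simp [coeff_derivHom]

theorem map_mulDeriv {S : Type*} [Ring S] (φ : R →+* S) (x y : ℕ → R) (p : ℕ) :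
    PowerSeries.map φ (mulDeriv x y p) = mulDeriv (fun k => φ (x k)) (fun k => φ (y k)) p := by
  rw [mulDeriv_eq, map_mul, map_iterate_derivHom, mulDeriv_eq]
  congr 2

variable {B : Type*} [Ring B] [Algebra ℚ B]

theorem coeff_mul_iterate_derivHom (x y : ℕ → B) (p n : ℕ) :
    PowerSeries.coeff n (PowerSeries.mk x * (derivHom B)^[p] (PowerSeries.mk y)) =
      ∑ q ∈ Finset.HasAntidiagonal.antidiagonal n,
        ((q.2 + 1).ascFactorial p : ℚ) • (x q.1 * y (q.2 + p)) := by
  have e : ∀ (p : ℕ) (f : B⟦X⟧) (n : ℕ), PowerSeries.coeff n ((derivHom B)^[p] f) =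
      ((n + 1).ascFactorial p : ℚ) • PowerSeries.coeff (n + p) f := by
    intro p
    induction p with
    | zero => intro f n; simp
    | succ p ih =>
      intro f n
      have h : ∀ x : B, ((n + p : ℕ) + 1 : B) * x = ((n + p + 1 : ℕ) : ℚ) • x := by
        intro x
        rw [Nat.cast_smul_eq_nsmul, nsmul_eq_mul]
        push_cast
        rfl
      rw [Function.iterate_succ_apply, ih, coeff_derivHom, h, smul_smul, Nat.ascFactorial_succ,
        ← add_assoc n]
      congr 1
      push_cast
      ring
  rw [PowerSeries.coeff_mul]
  refine Finset.sum_congr rfl fun q _ => ?_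
  rw [PowerSeries.coeff_mk, e, PowerSeries.coeff_mk, mul_smul_comm]

theorem mul_iterate_derivHom_comm {f g : B⟦X⟧} {c : ℚ}
    (h : ∀ k l, PowerSeries.coeff k f * PowerSeries.coeff l g =
      c • (PowerSeries.coeff l g * PowerSeries.coeff k f)) (p : ℕ) :
    f * (derivHom B)^[p] g = c • ((derivHom B)^[p] g * f) := by
  induction p generalizing g with
  | zero =>
    ext n
    change _ = c • PowerSeries.coeff n (g * f)
    rw [Function.iterate_zero, id_eq, PowerSeries.coeff_mul, PowerSeries.coeff_mul,
      ← Finset.Nat.sum_antidiagonal_swap, Finset.smul_sum]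
    exact Finset.sum_congr rfl fun q _ => h _ _
  | succ p ih =>
    rw [Function.iterate_succ_apply]
    refine ih fun k l => ?_
    have e : ∀ x : B, (l + 1 : B) * x = (l + 1) • x := fun x => by
      rw [nsmul_eq_mul]; push_cast; rfl
    rw [coeff_derivHom, e, mul_smul_comm, h, smul_mul_assoc, smul_comm]

end Series

/-! ### Generators and homomorphisms of the algebra of a quiver -/

section Basic

variable (V : Type u) [Quiver.{v} V]

/-- The generating series `e_i(z)`. -/
noncomputable def genSeries (i : V) : (QAlg V)⟦X⟧ := PowerSeries.mk (gen V i)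

variable {V}

theorem gen_mul_gen (i j : V) (k l : ℕ) : gen V i k * gen V j l =
    (-1 : ℚ) ^ (incidenceMatrix V i i * incidenceMatrix V j j) • (gen V j l * gen V i k) := by
  simpa only [map_mul, map_smul] using! proj_rel V (Rel.supercomm i j k l)

theorem vanish_genSeries (i j : V) :
    Vanish (derivHom _) (genSeries V i) (genSeries V j) (incidenceMatrix V i j) := by
  intro p hp
  ext n
  have h := proj_rel V (Rel.quadratic i j p n hp)
  rw [map_zero] at h
  rw [map_zero, ← h]
  change _ = (proj V : FreeAlgebra ℚ (V × ℕ) →+* QAlg V) _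
  rw [← PowerSeries.coeff_map, map_mulDeriv]
  rfl

variable {B : Type*} [Ring B] [Algebra ℚ B]

/-- The universal property of `A_Q`. -/
noncomputable def lift (g : V → ℕ → B)
   (hc : ∀ i j k l, g i k * g j l =
     (-1 : ℚ) ^ (incidenceMatrix V i i * incidenceMatrix V j j) • (g j l * g i k))
   (hq : ∀ i j, Vanish (derivHom B) (PowerSeries.mk (g i)) (PowerSeries.mk (g j))
     (incidenceMatrix V i j)) :
    QAlg V →ₐ[ℚ] B :=
  RingQuot.liftAlgHom ℚ ⟨FreeAlgebra.lift ℚ fun p : V × ℕ => g p.1 p.2, fun x y h => by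
    induction h with
    | supercomm i j k l => simpa [freeGen] using hc i j k l
    | quadratic i j p n hp =>
      have h := congrArg (PowerSeries.coeff n) (hq i j p hp)
      rw [map_zero] at h ⊢
      rw [← h]
      change ((FreeAlgebra.lift ℚ fun p : V × ℕ => g p.1 p.2 :
        FreeAlgebra ℚ (V × ℕ) →ₐ[ℚ] B) : FreeAlgebra ℚ (V × ℕ) →+* B) _ = _
      rw [← PowerSeries.coeff_map, map_mulDeriv]
      simp [freeGen, mulDeriv_eq]⟩

theorem lift_gen (g : V → ℕ → B)
  (hc : ∀ i j k l, g i k * g j l =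
    (-1 : ℚ) ^ (incidenceMatrix V i i * incidenceMatrix V j j) • (g j l * g i k))
  (hq : ∀ i j, Vanish (derivHom B) (PowerSeries.mk (g i)) (PowerSeries.mk (g j))
    (incidenceMatrix V i j))
  (i : V) (k : ℕ) : lift g hc hq (gen V i k) = g i k :=
  (RingQuot.liftAlgHom_mkAlgHom_apply ℚ _ _ _).trans (by simp [freeGen])

theorem QAlg.induction {p : QAlg V → Prop} (h1 : ∀ r : ℚ, p (algebraMap ℚ _ r))
    (hg : ∀ i k, p (gen V i k)) (hm : ∀ x y, p x → p y → p (x * y))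
    (ha : ∀ x y, p x → p y → p (x + y)) (x : QAlg V) : p x := by
  obtain ⟨y, rfl⟩ := RingQuot.mkAlgHom_surjective ℚ (Rel V) x
  induction y using FreeAlgebra.induction with
  | grade0 r => rw [AlgHom.commutes]; exact h1 r
  | grade1 v => exact hg v.1 v.2
  | mul a b ha hb => rw [map_mul]; exact hm _ _ ha hb
  | add a b ha' hb => rw [map_add]; exact ha _ _ ha' hb

theorem QAlg.hom_ext {φ ψ : QAlg V →ₐ[ℚ] B} (h : ∀ i k, φ (gen V i k) = ψ (gen V i k)) :
    φ = ψ := by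
  ext x
  induction x using QAlg.induction with
  | h1 r => simp
  | hg i k => exact h i k
  | hm x y hx hy => rw [map_mul, map_mul, hx, hy]
  | ha x y hx hy => rw [map_add, map_add, hx, hy]

/-- Skew derivations that agree on the generators are equal. -/
theorem QAlg.skew_ext {L R : QAlg V →ₐ[ℚ] B} {D E : QAlg V →ₗ[ℚ] B}
    (hD : ∀ x y, D (x * y) = D x * R y + L x * D y)
    (hE : ∀ x y, E (x * y) = E x * R y + L x * E y)
    (h : ∀ i k, D (gen V i k) = E (gen V i k)) : D = E := by
  have one : ∀ F : QAlg V →ₗ[ℚ] B, (∀ x y, F (x * y) = F x * R y + L x * F y) → F 1 = 0 := by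
    intro F hF
    simpa using hF 1 1
  ext x
  induction x using QAlg.induction with
  | h1 r => rw [Algebra.algebraMap_eq_smul_one, map_smul, map_smul, one D hD, one E hE]
  | hg i k => exact h i k
  | hm x y hx hy => rw [hD, hE, hx, hy]
  | ha x y hx hy => rw [map_add, map_add, hx, hy]

theorem QAlg.hom_surjective {φ : B →ₐ[ℚ] QAlg V} (h : ∀ i k, ∃ b, φ b = gen V i k) :
    Function.Surjective φ := by
  intro x
  induction x using QAlg.induction with
  | h1 r => exact ⟨algebraMap ℚ B r, φ.commutes r⟩
  | hg i k => exact h i k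
  | hm x y hx hy =>
    obtain ⟨a, rfl⟩ := hx
    obtain ⟨b, rfl⟩ := hy
    exact ⟨a * b, map_mul φ a b⟩
  | ha x y hx hy =>
    obtain ⟨a, rfl⟩ := hx
    obtain ⟨b, rfl⟩ := hy
    exact ⟨a + b, map_add φ a b⟩

end Basic

/-! ### Shifts of the generators -/

section Shift

variable {V : Type u} [Quiver.{v} V]

theorem mk_ite_eq {B : Type*} [Ring B] [Algebra ℚ B] (s : ℕ) (c : ℚ) (f : ℕ → B) :
    PowerSeries.mk (fun k => if s ≤ k then c • f (k - s) else 0) =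
      c • (PowerSeries.X ^ s * PowerSeries.mk f) := by
  ext n
  simp [PowerSeries.coeff_X_pow_mul']

theorem mul_X_comm {B : Type*} [Ring B] (x : B⟦X⟧) :
    x * PowerSeries.X = PowerSeries.X * x := (PowerSeries.commute_X x).eq

theorem Vanish.X_pow_mul {B : Type*} [Ring B] {x y : B⟦X⟧} {n : ℕ}
    (h : Vanish (derivHom B) x y n) (r s : ℕ) :
    Vanish (derivHom B) (PowerSeries.X ^ r * x) (PowerSeries.X ^ s * y) n := fun p hp => by
  rw [mul_assoc, h.mul_iterate_coord_pow_mul derivHom_mul derivHom_X mul_X_comm s p hp.le,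
    h p hp, mul_zero, mul_zero]

variable (V) in
/-- The endomorphism `e_j(z) ↦ u_j z^(s_j) e_j(z)` of `A_Q`. -/
noncomputable def shift (s : V → ℕ) (u : V → ℚ) : QAlg V →ₐ[ℚ] QAlg V :=
  lift (fun j k => if s j ≤ k then u j • gen V j (k - s j) else 0)
    (fun i j k l => by
      split_ifs
      · rw [smul_mul_smul_comm, gen_mul_gen i j, smul_mul_smul_comm, smul_comm, mul_comm (u i)]
      all_goals simp)
    (fun i j => by
      rw [mk_ite_eq, mk_ite_eq]
      exact ((vanish_genSeries i j).X_pow_mul _ _).smul _ _)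

theorem shift_gen (s : V → ℕ) (u : V → ℚ) (j : V) (k : ℕ) :
    shift V s u (gen V j k) = if s j ≤ k then u j • gen V j (k - s j) else 0 :=
  lift_gen _ _ _ j k

theorem shift_gen_add (s : V → ℕ) (u : V → ℚ) (j : V) (k : ℕ) :
    shift V s u (gen V j (k + s j)) = u j • gen V j k := by
  rw [shift_gen, if_pos (Nat.le_add_left _ _), Nat.add_sub_cancel]

theorem map_shift_genSeries (s : V → ℕ) (u : V → ℚ) (j : V) :
    PowerSeries.map (shift V s u : QAlg V →+* QAlg V) (genSeries V j) =
      u j • (PowerSeries.X ^ s j * genSeries V j) := by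
  rw [genSeries, ← mk_ite_eq]
  ext n
  simp [shift_gen]

theorem shift_shift (s t : V → ℕ) (u w : V → ℚ) (x : QAlg V) :
    shift V s u (shift V t w x) = shift V (s + t) (u * w) x := by
  have : (shift V s u).comp (shift V t w) = shift V (s + t) (u * w) := by
    refine QAlg.hom_ext fun j k => ?_
    rw [AlgHom.comp_apply, shift_gen, shift_gen]
    by_cases h1 : t j ≤ k
    · rw [if_pos h1, map_smul, shift_gen]
      by_cases h2 : s j ≤ k - t j
      · rw [if_pos h2, if_pos (by simp only [Pi.add_apply]; omega), smul_smul, Pi.mul_apply,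
          mul_comm, Pi.add_apply, Nat.sub_sub, add_comm]
      · rw [if_neg h2, if_neg (by simp only [Pi.add_apply]; omega), smul_zero]
    · rw [if_neg h1, if_neg (by simp only [Pi.add_apply]; omega), map_zero]
  exact DFunLike.congr_fun this x

theorem shift_zero_one (x : QAlg V) : shift V 0 1 x = x := by
  have : shift V 0 1 = AlgHom.id ℚ (QAlg V) := QAlg.hom_ext fun j k => by simp [shift_gen]
  exact DFunLike.congr_fun this x

theorem shift_surjective (s : V → ℕ) : Function.Surjective (shift V s 1) :=
  QAlg.hom_surjective fun j k => ⟨gen V j (k + s j), by rw [shift_gen_add, Pi.one_apply, one_smul]⟩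

theorem shift_comm (s t : V → ℕ) (u w : V → ℚ) (x : QAlg V) :
    shift V s u (shift V t w x) = shift V t w (shift V s u x) := by
  rw [shift_shift, shift_shift, add_comm, mul_comm]

/-- Kernels of shifts do not depend on the scalars, as long as these are not zero. -/
theorem shift_one_eq_zero {s : V → ℕ} {u : V → ℚ} (hu : ∀ j, u j ≠ 0) {x : QAlg V}
    (h : shift V s u x = 0) : shift V s 1 x = 0 := by
  have h1 := congrArg (shift V 0 u⁻¹) h
  rw [shift_shift, map_zero, zero_add] at h1
  rwa [show u⁻¹ * u = 1 from funext fun j => inv_mul_cancel₀ (hu j)] at h1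

/-- A homomorphism that kills the generators `e_{j,k}` with `k < s_j` factors through the shift
by `s`. -/
theorem eq_zero_of_shift_eq_zero {B : Type*} [Ring B] [Algebra ℚ B] (φ : QAlg V →ₐ[ℚ] B)
    (s : V → ℕ) (hφ : ∀ j, ∀ k < s j, φ (gen V j k) = 0) {x : QAlg V}
    (hx : shift V s 1 x = 0) : φ x = 0 := by
  have e : ∀ j, PowerSeries.map (φ : QAlg V →+* B) (genSeries V j) =
      PowerSeries.X ^ s j * PowerSeries.mk (fun k => φ (gen V j (k + s j))) := by
    intro j
    ext n
    rw [PowerSeries.coeff_X_pow_mul']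
    split_ifs with h
    · simp [genSeries, Nat.sub_add_cancel h]
    · simpa [genSeries] using hφ j n (by omega)
  let ψ : QAlg V →ₐ[ℚ] B := lift (fun j k => φ (gen V j (k + s j)))
    (fun i j k l => by rw [← map_mul, gen_mul_gen, map_smul, map_mul])
    (fun i j => by
      refine Vanish.of_coord_pow_mul (B := B⟦X⟧) (r := s i) (s := s j) derivHom_mul derivHom_X
        mul_X_comm (fun x hx => ?_) ?_
      · ext n
        rw [← PowerSeries.coeff_succ_X_mul, hx, map_zero, map_zero]
      · rw [← e, ← e]
        intro p hp
        rw [← map_iterate_derivHom, ← map_mul, vanish_genSeries i j p hp, map_zero])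
  have : φ = ψ.comp (shift V s 1) := QAlg.hom_ext fun j k => by
    rw [AlgHom.comp_apply, shift_gen]
    split_ifs with h
    · rw [Pi.one_apply, one_smul, lift_gen, Nat.sub_add_cancel h]
    · rw [map_zero, hφ j k (by omega)]
  rw [this, AlgHom.comp_apply, hx, map_zero]

/-- A generator commutes with all elements up to an automorphism by signs. -/
theorem gen_mul (c : V) (k : ℕ) (x : QAlg V) : gen V c k * x =
    shift V 0 (fun j => (-1) ^ (incidenceMatrix V c c * incidenceMatrix V j j)) x * gen V c k := by
  induction x using QAlg.induction with
  | h1 r => rw [AlgHom.commutes, Algebra.commutes]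
  | hg i l => simp [shift_gen, gen_mul_gen c i]
  | hm x y hx hy => rw [← mul_assoc, hx, mul_assoc, hy, map_mul, mul_assoc]
  | ha x y hx hy => rw [mul_add, hx, hy, map_add, add_mul]

theorem mul_gen (c : V) (k : ℕ) (x : QAlg V) : x * gen V c k =
    gen V c k * shift V 0 (fun j => (-1) ^ (incidenceMatrix V c c * incidenceMatrix V j j)) x := by
  rw [gen_mul, shift_shift]
  congr 1
  rw [zero_add]
  convert (shift_zero_one x).symm
  ext j
  rw [Pi.mul_apply, ← mul_pow]
  simp

/-- The kernel of `e_c(z) ↦ z e_c(z)` is the ideal generated by `e_{c,0}`. -/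
theorem exists_eq_gen_mul [DecidableEq V] (c : V) {x : QAlg V}
    (hx : shift V (Pi.single c 1) 1 x = 0) : ∃ y, x = gen V c 0 * y := by
  let J : Ideal (QAlg V) :=
    { carrier := {x | ∃ y, x = gen V c 0 * y}
      add_mem' := by
        rintro _ _ ⟨x, rfl⟩ ⟨y, rfl⟩
        exact ⟨x + y, (mul_add _ _ _).symm⟩
      zero_mem' := ⟨0, (mul_zero _).symm⟩
      smul_mem' := by
        rintro z _ ⟨y, rfl⟩
        exact ⟨_, by rw [smul_eq_mul, ← mul_assoc, mul_gen, mul_assoc]⟩ }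
  have : J.IsTwoSided := ⟨by
    rintro _ z ⟨y, rfl⟩
    exact ⟨y * z, mul_assoc _ _ _⟩⟩
  have h := eq_zero_of_shift_eq_zero (Ideal.Quotient.mkₐ ℚ J) (Pi.single c 1) (fun j k hk => ?_) hx
  · exact Ideal.Quotient.eq_zero_iff_mem.mp h
  · refine Ideal.Quotient.eq_zero_iff_mem.mpr ?_
    rcases eq_or_ne j c with rfl | hj
    · rw [Pi.single_eq_same, Nat.lt_one_iff] at hk
      exact ⟨1, by rw [hk, mul_one]⟩
    · simp [Pi.single_eq_of_ne hj] at hk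

theorem gen_zero_mul_gen (c j : V) (k : ℕ) (hk : k < incidenceMatrix V c j) :
    gen V c 0 * gen V j k = 0 := by
  have h := congrArg (PowerSeries.coeff 0) (vanish_genSeries c j k hk)
  rw [genSeries, genSeries, coeff_mul_iterate_derivHom, map_zero] at h
  simpa [Nat.factorial_ne_zero] using h

/-- The easy half of `gen_zero_mul_eq_zero_iff`: the annihilator of `e_{c,0}` is an ideal that
contains the `e_{j,k}` with `k < m_cj`. -/
theorem gen_zero_mul_eq_zero (c : V) {x : QAlg V}
    (hx : shift V (incidenceMatrix V c) 1 x = 0) : gen V c 0 * x = 0 := by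
  let J : Ideal (QAlg V) :=
    { carrier := {x | gen V c 0 * x = 0}
      add_mem' := by
        intro x y (hx : _ = _) (hy : _ = _)
        change _ = _
        rw [mul_add, hx, hy, add_zero]
      zero_mem' := mul_zero _
      smul_mem' := by
        intro z x (hx : _ = _)
        change _ = _
        rw [smul_eq_mul, ← mul_assoc, gen_mul, mul_assoc, hx, mul_zero] }
  have : J.IsTwoSided := ⟨by
    intro x z (hx : _ = _)
    change _ = _
    rw [← mul_assoc, hx, zero_mul]⟩
  exact Ideal.Quotient.eq_zero_iff_mem.mp <|
    eq_zero_of_shift_eq_zero (Ideal.Quotient.mkₐ ℚ J) (incidenceMatrix V c) (fun j k hk =>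
      Ideal.Quotient.eq_zero_iff_mem.mpr (gen_zero_mul_gen c j k hk)) hx

end Shift

/-! ### Power series in two variables -/

section TwoVariables

variable {S : Type*} [CommRing S]

/-- The exchange of the variables of a power series in two variables. -/
noncomputable def swapVars : S⟦X⟧⟦X⟧ →+* S⟦X⟧⟦X⟧ where
  toFun F := PowerSeries.mk fun l => PowerSeries.mk fun k =>
    PowerSeries.coeff l (PowerSeries.coeff k F)
  map_zero' := by ext; simp
  map_add' F G := by ext; simp
  map_one' := by
    ext l k
    simp only [PowerSeries.coeff_mk, PowerSeries.coeff_one]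
    split_ifs <;> simp_all
  map_mul' F G := by
    ext l k
    simp only [PowerSeries.coeff_mk, PowerSeries.coeff_mul, map_sum]
    exact Finset.sum_comm

theorem coeff_coeff_swapVars (F : S⟦X⟧⟦X⟧) (k l : ℕ) :
    PowerSeries.coeff k (PowerSeries.coeff l (swapVars F)) =
      PowerSeries.coeff l (PowerSeries.coeff k F) := by
  simp [swapVars]

theorem swapVars_C (f : S⟦X⟧) :
    swapVars (PowerSeries.C f) = PowerSeries.map (PowerSeries.C : S →+* S⟦X⟧) f := by
  ext l k
  rw [coeff_coeff_swapVars, PowerSeries.coeff_map, PowerSeries.coeff_C, PowerSeries.coeff_C]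
  split_ifs <;> simp

theorem swapVars_map_C (f : S⟦X⟧) :
    swapVars (PowerSeries.map (PowerSeries.C : S →+* S⟦X⟧) f) = PowerSeries.C f := by
  ext l k
  rw [coeff_coeff_swapVars, PowerSeries.coeff_map, PowerSeries.coeff_C, PowerSeries.coeff_C]
  split_ifs <;> simp

theorem swapVars_C_X : swapVars (PowerSeries.C PowerSeries.X : S⟦X⟧⟦X⟧) = PowerSeries.X := by
  rw [swapVars_C, PowerSeries.map_X]

theorem swapVars_X : swapVars (PowerSeries.X : S⟦X⟧⟦X⟧) = PowerSeries.C PowerSeries.X := by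
  rw [← swapVars_map_C, PowerSeries.map_X]

theorem swapVars_C_C (x : S) :
    swapVars (PowerSeries.C (PowerSeries.C x)) = PowerSeries.C (PowerSeries.C x) := by
  rw [swapVars_C, PowerSeries.map_C]

variable (S) in
/-- The difference `z - w` in `S⟦z⟧⟦w⟧`. -/
noncomputable def varDiff : S⟦X⟧⟦X⟧ := PowerSeries.C PowerSeries.X - PowerSeries.X

theorem swapVars_varDiff : swapVars (varDiff S) = -varDiff S := by
  rw [varDiff, map_sub, swapVars_C_X, swapVars_X, neg_sub]

theorem map_map_varDiff {T : Type*} [CommRing T] (φ : S →+* T) :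
    PowerSeries.map (PowerSeries.map φ) (varDiff S) = varDiff T := by
  simp [varDiff]

/-- A multiple of `z - w` vanishes on the diagonal `z = w`. -/
theorem sum_coeff_coeff_varDiff_mul (H : S⟦X⟧⟦X⟧) (n : ℕ) :
    ∑ p ∈ Finset.HasAntidiagonal.antidiagonal n,
      PowerSeries.coeff p.1 (PowerSeries.coeff p.2 (varDiff S * H)) = 0 := by
  simp only [varDiff, sub_mul, map_sub, PowerSeries.coeff_C_mul, Finset.sum_sub_distrib]
  rcases n with _ | n
  · simp
  · rw [Finset.Nat.sum_antidiagonal_succ, Finset.Nat.sum_antidiagonal_succ']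
    simp [PowerSeries.coeff_succ_X_mul]

theorem derivHom_varDiff_pow_mul (n : ℕ) (K : S⟦X⟧⟦X⟧) :
    ∃ K', derivHom _ (varDiff S ^ (n + 1) * K) = varDiff S ^ n * K' := by
  induction n generalizing K with
  | zero => exact ⟨derivHom _ (varDiff S ^ 1 * K), by simp⟩
  | succ n ih =>
    obtain ⟨K', h⟩ := ih K
    refine ⟨derivHom _ (varDiff S) * K + K', ?_⟩
    rw [pow_succ', mul_assoc, derivHom_mul, h, pow_succ']
    ring

theorem iterate_derivHom_varDiff_pow_mul (p n : ℕ) (K : S⟦X⟧⟦X⟧) :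
    ∃ K', (derivHom _)^[p] (varDiff S ^ (n + p) * K) = varDiff S ^ n * K' := by
  induction p generalizing K with
  | zero => exact ⟨K, rfl⟩
  | succ p ih =>
    obtain ⟨K', h⟩ := derivHom_varDiff_pow_mul (n + p) K
    obtain ⟨K'', h'⟩ := ih K'
    exact ⟨K'', by rw [Function.iterate_succ_apply, ← add_assoc, h, h']⟩

theorem pmap_pmap {R T U : Type*} [Ring R] [Ring T] [Ring U] (φ : T →+* U) (ψ : R →+* T)
    (f : R⟦X⟧) : PowerSeries.map φ (PowerSeries.map ψ f) = PowerSeries.map (φ.comp ψ) f := by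
  ext; simp

theorem pmap_C {R T : Type*} [Ring R] [Ring T] (φ : R →+* T) (x : R) :
    PowerSeries.map φ (PowerSeries.C x) = PowerSeries.C (φ x) := PowerSeries.map_C φ x

theorem pmap_comp_C {R T : Type*} [Ring R] [Ring T] (φ : R →+* T) :
    (PowerSeries.map φ).comp PowerSeries.C = PowerSeries.C.comp φ := RingHom.ext (pmap_C φ)

/-- The derivative in `w` of the series `∑ a_k (A_l f) z^k w^l`. -/
theorem mk_mk_apply_iterate_derivHom [Algebra ℚ S] (a : ℕ → Module.End ℚ S) (f : S) (p : ℕ)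
    (A : (Module.End ℚ S)⟦X⟧) :
    (PowerSeries.mk fun l => PowerSeries.mk fun k =>
        a k (PowerSeries.coeff l ((derivHom _)^[p] A) f)) =
      (derivHom S⟦X⟧)^[p] (PowerSeries.mk fun l => PowerSeries.mk fun k =>
        a k (PowerSeries.coeff l A f)) := by
  induction p generalizing A with
  | zero => rfl
  | succ p ih =>
    rw [Function.iterate_succ_apply, ih, Function.iterate_succ_apply]
    congr 1
    ext1 l
    rw [coeff_derivHom, PowerSeries.coeff_mk, PowerSeries.coeff_mk, coeff_derivHom]
    ext1 k
    have e : ((l : Module.End ℚ S) + 1) * PowerSeries.coeff (l + 1) A =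
        (l + 1) • PowerSeries.coeff (l + 1) A := by rw [nsmul_eq_mul]; push_cast; rfl
    have e' : ∀ g : S⟦X⟧, ((l : S⟦X⟧) + 1) * g = (l + 1) • g := by
      intro g; rw [nsmul_eq_mul]; push_cast; rfl
    rw [e, e', map_nsmul, PowerSeries.coeff_mk, PowerSeries.coeff_mk, LinearMap.smul_apply,
      map_nsmul]

end TwoVariables

/-! ### The action by vertex operators -/

section Vertex

variable (V : Type u) [Quiver.{v} V]

/-- The polynomial ring in commuting variables `x_{j,k}`. -/
abbrev Fock : Type u := MvPolynomial (V × ℕ) ℚ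

/-- The generating series `x_j(z)` of the variables. -/
noncomputable def varSeries (j : V) : (Fock V)⟦X⟧ :=
  PowerSeries.mk fun k => MvPolynomial.X (j, k)

variable {V}

omit [Quiver V] in
theorem Fock.ringHom_ext {R : Type*} [CommRing R] {φ ψ : Fock V →+* R}
    (h : ∀ j, PowerSeries.map φ (varSeries V j) = PowerSeries.map ψ (varSeries V j)) : φ = ψ := by
  refine MvPolynomial.ringHom_ext' (RingHom.ext_rat _ _) fun p => ?_
  have := congrArg (PowerSeries.coeff p.2) (h p.1)
  simpa [varSeries] using this

variable (V) in
open Classical in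
/-- Signs `ε_ij` that correct the commutation sign `(-1)^(m_ij)` of the vertex operators to
`(-1)^(m_ii m_jj)`. -/
noncomputable def cocycle (i j : V) : ℤ :=
  if WellOrderingRel i j then
    (-1) ^ (incidenceMatrix V i i * incidenceMatrix V j j + incidenceMatrix V i j) else 1

theorem cocycle_mul_self (i j : V) : cocycle V i j * cocycle V i j = 1 := by
  unfold cocycle
  split_ifs
  · rw [← mul_pow]; simp
  · rfl

theorem cocycle_mul_cocycle (hV : IsSymmetric V) (i j : V) :
    cocycle V i j * cocycle V j i * (-1) ^ incidenceMatrix V i j =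
      (-1) ^ (incidenceMatrix V i i * incidenceMatrix V j j) := by
  have hs : incidenceMatrix V j i = incidenceMatrix V i j := hV.apply i j
  rcases eq_or_ne i j with rfl | hij
  · rw [cocycle_mul_self, one_mul, neg_one_pow_congr]
    simp [Nat.even_mul]
  · unfold cocycle
    rcases trichotomous_of WellOrderingRel i j with h | h | h
    · rw [if_pos h, if_neg (asymm h), mul_one, pow_add, mul_assoc, ← mul_pow]
      simp
    · exact absurd h hij
    · rw [if_neg (asymm h), if_pos h, one_mul, pow_add, hs, mul_assoc, ← mul_pow, mul_comm
        (incidenceMatrix V j j)]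
      simp

/-- The homomorphism `x_j(w) ↦ ε_ij (z - w)^(m_ij) x_j(w)` from the polynomial ring `S` to
`S⟦z⟧`. -/
noncomputable def dressing (i : V) : Fock V →ₐ[ℚ] (Fock V)⟦X⟧ :=
  MvPolynomial.aeval fun p => PowerSeries.coeff p.2
    ((cocycle V i p.1 : (Fock V)⟦X⟧⟦X⟧) * (varDiff (Fock V) ^ incidenceMatrix V i p.1 *
      PowerSeries.map PowerSeries.C (varSeries V p.1)))

theorem map_dressing (i j : V) :
    PowerSeries.map (dressing i : Fock V →+* (Fock V)⟦X⟧) (varSeries V j) =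
      (cocycle V i j : (Fock V)⟦X⟧⟦X⟧) * (varDiff (Fock V) ^ incidenceMatrix V i j *
        PowerSeries.map PowerSeries.C (varSeries V j)) := by
  ext1 n
  simp [varSeries, dressing]

/-- The composite of two dressings, as series in three variables. -/
theorem map_map_dressing (i j l : V) :
    PowerSeries.map ((PowerSeries.map (dressing i : Fock V →+* (Fock V)⟦X⟧)).comp
      (dressing j : Fock V →+* (Fock V)⟦X⟧)) (varSeries V l) =
    ((cocycle V j l : (Fock V)⟦X⟧⟦X⟧⟦X⟧) *
      (PowerSeries.C PowerSeries.X - PowerSeries.X) ^ incidenceMatrix V j l) *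
    ((cocycle V i l : (Fock V)⟦X⟧⟦X⟧⟦X⟧) *
      (PowerSeries.C (PowerSeries.C PowerSeries.X) - PowerSeries.X) ^ incidenceMatrix V i l) *
    PowerSeries.map (PowerSeries.C.comp PowerSeries.C) (varSeries V l) := by
  rw [← pmap_pmap, map_dressing]
  rw [map_mul, map_intCast, map_mul, map_pow, pmap_pmap, pmap_comp_C, ← pmap_pmap, map_dressing]
  simp only [varDiff, map_mul, map_intCast, map_pow, map_sub, pmap_C, PowerSeries.map_X,
    pmap_pmap]
  ring

theorem swapVars_map_dressing (i j : V) (f : Fock V) :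
    swapVars (PowerSeries.map (dressing i : Fock V →+* (Fock V)⟦X⟧) (dressing j f)) =
      PowerSeries.map (dressing j : Fock V →+* (Fock V)⟦X⟧) (dressing i f) := by
  have : swapVars.comp ((PowerSeries.map (dressing i : Fock V →+* (Fock V)⟦X⟧)).comp
      (dressing j : Fock V →+* (Fock V)⟦X⟧)) =
      (PowerSeries.map (dressing j : Fock V →+* (Fock V)⟦X⟧)).comp
        (dressing i : Fock V →+* (Fock V)⟦X⟧) := by
    refine Fock.ringHom_ext fun l => ?_
    have h : (swapVars : (Fock V)⟦X⟧⟦X⟧ →+* _).comp (PowerSeries.C.comp PowerSeries.C) =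
        PowerSeries.C.comp PowerSeries.C := RingHom.ext swapVars_C_C
    rw [← pmap_pmap, map_map_dressing, map_map_dressing]
    simp only [map_mul, map_intCast, map_pow, map_sub, pmap_C, PowerSeries.map_X, swapVars_C_X,
      swapVars_X, pmap_pmap, h]
    ring
  exact DFunLike.congr_fun this f

/-- The modes of the vertex operator `f ↦ x_i(z) * dressing i f`. -/
noncomputable def vertexOp (i : V) (k : ℕ) : Module.End ℚ (Fock V) where
  toFun f := PowerSeries.coeff k (varSeries V i * dressing i f)
  map_add' f g := by rw [map_add, mul_add, map_add]
  map_smul' c f := by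
    rw [map_smul, mul_smul_comm, RingHom.id_apply]
    rfl

theorem vertexOp_apply (i : V) (k : ℕ) (f : Fock V) :
    vertexOp i k f = PowerSeries.coeff k (varSeries V i * dressing i f) := rfl

/-- The generating series of `vertexOp i k (vertexOp j l f)`, without the factor
`ε_ij (z - w)^(m_ij)`. -/
noncomputable def normalOrdered (i j : V) (f : Fock V) : (Fock V)⟦X⟧⟦X⟧ :=
  PowerSeries.C (varSeries V i) * PowerSeries.map PowerSeries.C (varSeries V j) *
    PowerSeries.map (dressing i : Fock V →+* (Fock V)⟦X⟧) (dressing j f)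

theorem swapVars_normalOrdered (i j : V) (f : Fock V) :
    swapVars (normalOrdered i j f) = normalOrdered j i f := by
  rw [normalOrdered, map_mul, map_mul, swapVars_C, swapVars_map_C, swapVars_map_dressing,
    normalOrdered, mul_comm (PowerSeries.C _)]

/-- The operator product expansion `E_i(z) E_j(w) = ε_ij (z - w)^(m_ij) : E_i(z) E_j(w) :`. -/
theorem mk_vertexOp_vertexOp (i j : V) (f : Fock V) :
    (PowerSeries.mk fun l => PowerSeries.mk fun k => vertexOp i k (vertexOp j l f)) =
      (cocycle V i j : (Fock V)⟦X⟧⟦X⟧) *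
        (varDiff (Fock V) ^ incidenceMatrix V i j * normalOrdered i j f) := by
  have h : (PowerSeries.mk fun l => PowerSeries.mk fun k => vertexOp i k (vertexOp j l f)) =
      PowerSeries.C (varSeries V i) *
        PowerSeries.map (dressing i : Fock V →+* (Fock V)⟦X⟧) (varSeries V j * dressing j f) := by
    ext1 l
    ext1 k
    rw [PowerSeries.coeff_C_mul, PowerSeries.coeff_map, PowerSeries.coeff_mk,
      PowerSeries.coeff_mk]
    rfl
  rw [h, map_mul, map_dressing, normalOrdered]
  ring

theorem vertexOp_vertexOp (i j : V) (k l : ℕ) (f : Fock V) :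
    vertexOp i k (vertexOp j l f) = PowerSeries.coeff k (PowerSeries.coeff l
      ((cocycle V i j : (Fock V)⟦X⟧⟦X⟧) *
        (varDiff (Fock V) ^ incidenceMatrix V i j * normalOrdered i j f))) := by
  rw [← mk_vertexOp_vertexOp, PowerSeries.coeff_mk, PowerSeries.coeff_mk]

theorem vertexOp_comm (hV : IsSymmetric V) (i j : V) (k l : ℕ) :
    vertexOp i k * vertexOp j l =
      (-1 : ℚ) ^ (incidenceMatrix V i i * incidenceMatrix V j j) •
        (vertexOp j l * vertexOp i k) := by
  refine LinearMap.ext fun f => ?_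
  have hs : incidenceMatrix V j i = incidenceMatrix V i j := hV.apply i j
  have e : (cocycle V i j : (Fock V)⟦X⟧⟦X⟧) *
        (varDiff (Fock V) ^ incidenceMatrix V i j * normalOrdered i j f) =
      ((-1 : ℤ) ^ (incidenceMatrix V i i * incidenceMatrix V j j)) • swapVars
        ((cocycle V j i : (Fock V)⟦X⟧⟦X⟧) *
        (varDiff (Fock V) ^ incidenceMatrix V j i * normalOrdered j i f)) := by
    rw [map_mul, map_mul, map_pow, map_intCast, swapVars_varDiff, swapVars_normalOrdered, hs,
      ← cocycle_mul_cocycle hV, neg_pow, zsmul_eq_mul]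
    have h1 := congrArg (Int.cast : ℤ → (Fock V)⟦X⟧⟦X⟧) (cocycle_mul_self j i)
    have h2 : ((-1 : (Fock V)⟦X⟧⟦X⟧) ^ incidenceMatrix V i j) ^ 2 = 1 := by
      rw [← pow_mul, mul_comm, pow_mul]; simp
    push_cast at h1 ⊢
    linear_combination (-(cocycle V i j : (Fock V)⟦X⟧⟦X⟧) *
        (varDiff (Fock V) ^ incidenceMatrix V i j * normalOrdered i j f)) *
        (h2 + ((-1 : (Fock V)⟦X⟧⟦X⟧) ^ incidenceMatrix V i j) ^ 2 * h1)
  change vertexOp i k (vertexOp j l f) =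
    ((-1 : ℚ) ^ (incidenceMatrix V i i * incidenceMatrix V j j)) • vertexOp j l (vertexOp i k f)
  rw [vertexOp_vertexOp, vertexOp_vertexOp, e, map_zsmul, map_zsmul, coeff_coeff_swapVars,
    ← Int.cast_smul_eq_zsmul ℚ]
  push_cast
  rfl

theorem vanish_vertexOp (i j : V) : Vanish (derivHom _) (PowerSeries.mk (vertexOp i))
    (PowerSeries.mk (vertexOp j)) (incidenceMatrix V i j) := by
  intro p hp
  ext1 n
  refine LinearMap.ext fun f => ?_
  have h := mk_mk_apply_iterate_derivHom (vertexOp i) f p (PowerSeries.mk (vertexOp j))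
  simp only [PowerSeries.coeff_mk] at h
  rw [mk_vertexOp_vertexOp, mul_left_comm,
    show incidenceMatrix V i j = (incidenceMatrix V i j - p - 1 + 1) + p by omega] at h
  obtain ⟨K, hK⟩ := iterate_derivHom_varDiff_pow_mul p (incidenceMatrix V i j - p - 1 + 1)
    ((cocycle V i j : (Fock V)⟦X⟧⟦X⟧) * normalOrdered i j f)
  rw [hK, pow_succ', mul_assoc] at h
  rw [PowerSeries.coeff_mul, LinearMap.sum_apply, map_zero, LinearMap.zero_apply,
    ← sum_coeff_coeff_varDiff_mul (varDiff (Fock V) ^ (incidenceMatrix V i j - p - 1) * K) n, ← h]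
  refine Finset.sum_congr rfl fun q _ => ?_
  rw [PowerSeries.coeff_mk, PowerSeries.coeff_mk, PowerSeries.coeff_mk]
  rfl

/-- The representation of `A_Q` on the polynomial ring by vertex operators. -/
noncomputable def vertexRep (hV : IsSymmetric V) : QAlg V →ₐ[ℚ] Module.End ℚ (Fock V) :=
  lift vertexOp (vertexOp_comm hV) vanish_vertexOp

theorem vertexRep_gen (hV : IsSymmetric V) (i : V) (k : ℕ) :
    vertexRep hV (gen V i k) = vertexOp i k := lift_gen _ _ _ i k

/-- The endomorphism `x_j(z) ↦ u_j z^(s_j) x_j(z)` of the polynomial ring. -/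
noncomputable def fockShift (s : V → ℕ) (u : V → ℤ) : Fock V →ₐ[ℚ] Fock V :=
  MvPolynomial.aeval fun p => if s p.1 ≤ p.2 then
    (u p.1 : Fock V) * MvPolynomial.X (p.1, p.2 - s p.1) else 0

omit [Quiver V] in
theorem map_fockShift (s : V → ℕ) (u : V → ℤ) (j : V) :
    PowerSeries.map (fockShift s u : Fock V →+* Fock V) (varSeries V j) =
      (u j : (Fock V)⟦X⟧) * (PowerSeries.X ^ s j * varSeries V j) := by
  ext1 n
  have : (u j : (Fock V)⟦X⟧) = PowerSeries.C (u j : Fock V) := (map_intCast _ _).symm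
  rw [this, PowerSeries.coeff_C_mul, PowerSeries.coeff_X_pow_mul']
  simp [varSeries, fockShift]

theorem map_fockShift_dressing (s : V → ℕ) (u : V → ℤ) (j : V) (f : Fock V) :
    PowerSeries.map (fockShift s u : Fock V →+* Fock V) (dressing j f) =
      dressing j (fockShift s u f) := by
  have : (PowerSeries.map (fockShift s u : Fock V →+* Fock V)).comp
      (dressing j : Fock V →+* (Fock V)⟦X⟧) =
      (dressing j : Fock V →+* (Fock V)⟦X⟧).comp (fockShift s u : Fock V →+* Fock V) := by
    refine Fock.ringHom_ext fun l => ?_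
    rw [← pmap_pmap, ← pmap_pmap, map_dressing, map_fockShift, map_mul, map_mul, map_mul, map_mul,
      map_pow, map_map_varDiff, pmap_pmap, pmap_comp_C, ← pmap_pmap, map_fockShift, map_dressing]
    simp only [map_mul, map_intCast, map_pow, PowerSeries.map_X]
    ring
  exact DFunLike.congr_fun this f

theorem fockShift_vertexRep (hV : IsSymmetric V) (s : V → ℕ) (u : V → ℤ) (x : QAlg V)
    (f : Fock V) : fockShift s u (vertexRep hV x f) =
      vertexRep hV (shift V s (fun j => u j) x) (fockShift s u f) := by
  induction x using QAlg.induction generalizing f with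
  | h1 r => simp
  | hg i k =>
    have h : fockShift s u (vertexOp i k f) = PowerSeries.coeff k
        ((u i : (Fock V)⟦X⟧) * (PowerSeries.X ^ s i * (varSeries V i *
          dressing i (fockShift s u f)))) := by
      rw [vertexOp_apply]
      change (fockShift s u : Fock V →+* Fock V) _ = _
      rw [← PowerSeries.coeff_map, map_mul, map_fockShift, map_fockShift_dressing]
      congr 1
      ring
    have : (u i : (Fock V)⟦X⟧) = PowerSeries.C (u i : Fock V) := (map_intCast _ _).symm
    rw [vertexRep_gen, h, this, PowerSeries.coeff_C_mul, PowerSeries.coeff_X_pow_mul', shift_gen]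
    split_ifs
    · rw [map_smul, vertexRep_gen, LinearMap.smul_apply, vertexOp_apply, Int.cast_smul_eq_zsmul,
        zsmul_eq_mul]
    · simp
  | hm x y hx hy =>
    rw [map_mul, map_mul, map_mul, Module.End.mul_apply, Module.End.mul_apply, hx, hy]
  | ha x y hx hy =>
    rw [map_add, map_add, map_add, LinearMap.add_apply, LinearMap.add_apply, map_add, hx, hy]

/-- The lowest mode of a vertex operator is a shift of the variables, followed by multiplication
by a variable. -/
theorem vertexOp_zero (c : V) (f : Fock V) : vertexOp c 0 f = MvPolynomial.X (c, 0) *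
    fockShift (incidenceMatrix V c) (fun j => cocycle V c j * (-1) ^ incidenceMatrix V c j) f := by
  have h : (PowerSeries.constantCoeff : (Fock V)⟦X⟧ →+* Fock V).comp
      (dressing c : Fock V →+* (Fock V)⟦X⟧) =
      (fockShift (incidenceMatrix V c) (fun j => cocycle V c j * (-1) ^ incidenceMatrix V c j) :
        Fock V →+* Fock V) := by
    refine Fock.ringHom_ext fun l => ?_
    have h : (PowerSeries.constantCoeff : (Fock V)⟦X⟧ →+* Fock V).comp PowerSeries.C =
        RingHom.id _ := RingHom.ext PowerSeries.constantCoeff_C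
    rw [← pmap_pmap, map_dressing, map_fockShift, map_mul, map_mul, pmap_pmap, h]
    simp only [varDiff, map_intCast, map_pow, map_sub, pmap_C, PowerSeries.map_X,
      PowerSeries.constantCoeff_X, map_zero, zero_sub]
    rw [neg_pow]
    push_cast
    simp only [PowerSeries.map_id, id_eq]
    ring
  rw [vertexOp_apply, PowerSeries.coeff_zero_eq_constantCoeff_apply, map_mul]
  have h' := DFunLike.congr_fun h f
  simp only [RingHom.comp_apply, RingHom.coe_coe] at h'
  rw [h', varSeries]
  simp

/-- The linear map `x ↦ x · 1` from `A_Q` to the polynomial ring. -/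
noncomputable def toFock (hV : IsSymmetric V) : QAlg V →ₗ[ℚ] Fock V :=
  LinearMap.applyₗ (1 : Fock V) ∘ₗ (vertexRep hV).toLinearMap

theorem toFock_apply (hV : IsSymmetric V) (x : QAlg V) : toFock hV x = vertexRep hV x 1 := rfl

theorem fockShift_toFock (hV : IsSymmetric V) (s : V → ℕ) (u : V → ℤ) (x : QAlg V) :
    fockShift s u (toFock hV x) = toFock hV (shift V s (fun j => u j) x) := by
  rw [toFock_apply, fockShift_vertexRep, map_one, toFock_apply]

theorem toFock_gen_zero_mul (hV : IsSymmetric V) (c : V) (x : QAlg V) :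
    toFock hV (gen V c 0 * x) = MvPolynomial.X (c, 0) * toFock hV
      (shift V (incidenceMatrix V c)
        (fun j => ((cocycle V c j * (-1) ^ incidenceMatrix V c j : ℤ) : ℚ)) x) := by
  rw [← fockShift_toFock, toFock_apply, map_mul, Module.End.mul_apply, vertexRep_gen,
    vertexOp_zero, toFock_apply]

end Vertex

/-! ### Gradings by weights of the vertices -/

section Eigen

/-- Eigenvectors with the pairwise different eigenvalues `c * 2 ^ n` are linearly independent. -/
theorem eq_zero_of_sum_eigen {M : Type*} [AddCommGroup M] [Module ℚ M] (φ : Module.End ℚ M)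
    {c : ℚ} (hc : c ≠ 0) (S : Finset ℕ) (z : ℕ → M)
    (hz : ∀ n ∈ S, φ (z n) = (c * 2 ^ n) • z n) (h : ∑ n ∈ S, z n = 0) : ∀ n ∈ S, z n = 0 := by
  have h1 := (Module.End.eigenspaces_iSupIndep φ).comp (f := fun n : ℕ => c * 2 ^ n)
    fun m n hmn => Nat.pow_right_injective le_rfl (by
      have := mul_left_cancel₀ hc hmn
      exact_mod_cast this)
  rw [iSupIndep_iff_finsetSum_eq_zero_imp_eq_zero] at h1
  exact h1 S z (fun n hn => Module.End.mem_eigenspace_iff.mpr (hz n hn)) h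

end Eigen

section Grading

variable {V : Type u} [Quiver.{v} V]

/-- The elements of degree `n` of `A_Q`, for the grading in which `e_{j,k}` has degree `s_j`. It
is encoded as an eigenspace of the automorphism `e_{j,k} ↦ 2^(s_j) e_{j,k}`. -/
noncomputable def degPart (s : V → ℕ) (n : ℕ) : Submodule ℚ (QAlg V) :=
  Module.End.eigenspace (shift V 0 (fun j => 2 ^ s j)).toLinearMap (2 ^ n)

theorem mem_degPart {s : V → ℕ} {n : ℕ} {x : QAlg V} :
    x ∈ degPart s n ↔ shift V 0 (fun j => 2 ^ s j) x = (2 : ℚ) ^ n • x :=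
  Module.End.mem_eigenspace_iff

theorem gen_mem_degPart (s : V → ℕ) (j : V) (k : ℕ) : gen V j k ∈ degPart s (s j) := by
  rw [mem_degPart, shift_gen]; simp

theorem mul_mem_degPart {s : V → ℕ} {m n : ℕ} {x y : QAlg V} (hx : x ∈ degPart s m)
    (hy : y ∈ degPart s n) : x * y ∈ degPart s (m + n) := by
  rw [mem_degPart] at *
  rw [map_mul, hx, hy, smul_mul_smul_comm, pow_add]

theorem shift_mem_degPart {s : V → ℕ} {n : ℕ} {x : QAlg V} (t : V → ℕ) (w : V → ℚ)
    (hx : x ∈ degPart s n) : shift V t w x ∈ degPart s n := by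
  rw [mem_degPart] at *
  rw [shift_comm, hx, map_smul]

variable (V) in
/-- The endomorphism of `A_Q` that is the projection to the part of degree zero, for the grading
in which `e_{j,k}` has degree `s_j`: it kills the generators of positive degree. -/
noncomputable def degZero (s : V → ℕ) : QAlg V →ₐ[ℚ] QAlg V := shift V 0 (fun j => 0 ^ s j)

theorem degZero_gen (s : V → ℕ) (j : V) (k : ℕ) :
    degZero V s (gen V j k) = (0 : ℚ) ^ s j • gen V j k := by
  rw [degZero, shift_gen]; simp

theorem degZero_mem (s : V → ℕ) (x : QAlg V) : degZero V s x ∈ degPart s 0 := by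
  rw [mem_degPart, degZero, shift_shift, pow_zero, one_smul]
  congr 2
  ext j
  rcases eq_or_ne (s j) 0 with h | h <;> simp [h]

theorem degZero_eq_zero {s : V → ℕ} {n : ℕ} (hn : n ≠ 0) {x : QAlg V} (hx : x ∈ degPart s n) :
    degZero V s x = 0 := by
  have h1 := congrArg (degZero V s) (mem_degPart.mp hx)
  have h2 : degZero V s (shift V 0 (fun j => 2 ^ s j) x) = degZero V s x := by
    rw [degZero, shift_shift]
    congr 2
    ext j
    rcases eq_or_ne (s j) 0 with h | h <;> simp [h]
  rw [h2, map_smul] at h1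
  have h3 : ((1 : ℚ) - 2 ^ n) • degZero V s x = 0 := by
    rw [sub_smul, one_smul, ← h1, sub_self]
  refine (smul_eq_zero.mp h3).resolve_left fun h => ?_
  have : (1 : ℚ) < 2 ^ n := one_lt_pow₀ (by norm_num) hn
  linarith

theorem sub_degZero_mem (s : V → ℕ) (x : QAlg V) :
    x - degZero V s x ∈ ⨆ n, degPart s (n + 1) := by
  have h1 : ∀ p ∈ ⨆ n, degPart s (n + 1), ∀ m, ∀ q ∈ degPart s m,
      p * q ∈ ⨆ n, degPart s (n + 1) ∧ q * p ∈ ⨆ n, degPart s (n + 1) := by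
    intro p hp m q hq
    induction hp using Submodule.iSup_induction' with
    | mem n p hp =>
      refine ⟨Submodule.mem_iSup_of_mem (n + m) ?_, Submodule.mem_iSup_of_mem (n + m) ?_⟩
      · rw [add_right_comm]; exact mul_mem_degPart hp hq
      · rw [add_right_comm, add_comm]; exact mul_mem_degPart hq hp
    | zero => simp
    | add p p' _ _ h h' =>
      rw [add_mul, mul_add]
      exact ⟨add_mem h.1 h'.1, add_mem h.2 h'.2⟩
  have h2 : ∀ p ∈ ⨆ n, degPart s (n + 1), ∀ q ∈ ⨆ n, degPart s (n + 1),
      p * q ∈ ⨆ n, degPart s (n + 1) := by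
    intro p hp q hq
    induction hq using Submodule.iSup_induction' with
    | mem n q hq => exact (h1 p hp _ q hq).1
    | zero => simp
    | add q q' _ _ h h' => rw [mul_add]; exact add_mem h h'
  induction x using QAlg.induction with
  | h1 r => simp
  | hg j k =>
    rw [degZero_gen]
    rcases h : s j with _ | n
    · simp
    · rw [zero_pow (Nat.succ_ne_zero n), zero_smul, sub_zero]
      exact Submodule.mem_iSup_of_mem n (h ▸ gen_mem_degPart s j k)
  | hm x y hx hy =>
    have e : x * y - degZero V s (x * y) = (x - degZero V s x) * (y - degZero V s y) +
        (degZero V s x * (y - degZero V s y) + (x - degZero V s x) * degZero V s y) := by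
      rw [map_mul]; noncomm_ring
    rw [e]
    exact add_mem (h2 _ hx _ hy) (add_mem (h1 _ hy _ _ (degZero_mem s x)).2
      (h1 _ hx _ _ (degZero_mem s y)).1)
  | ha x y hx hy =>
    rw [map_add, add_sub_add_comm]
    exact add_mem hx hy

theorem exists_degPart_decomposition (s : V → ℕ) (x : QAlg V) : ∃ (S : Finset ℕ)
    (g : ℕ → QAlg V), (∀ n, g n ∈ degPart s n) ∧ ∑ n ∈ S, g n = x := by
  have h : x ∈ ⨆ n, degPart s n := by
    rw [← sub_add_cancel x (degZero V s x)]
    refine add_mem ?_ (Submodule.mem_iSup_of_mem 0 (degZero_mem s x))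
    exact iSup_le (fun n => le_iSup (degPart s) (n + 1)) (sub_degZero_mem s x)
  obtain ⟨f, hf, h⟩ := (Submodule.mem_iSup_iff_exists_finsupp _ _).mp h
  exact ⟨f.support, f, hf, h⟩

theorem degZero_eq_self {s : V → ℕ} {x : QAlg V} (hx : x ∈ degPart s 0) : degZero V s x = x := by
  obtain ⟨f, hf, h⟩ := (Submodule.mem_iSup_iff_exists_finsupp _ _).mp (sub_degZero_mem s x)
  have h0 := sub_mem hx (degZero_mem s x)
  have hs : ∑ n ∈ insert 0 (f.support.map ⟨Nat.succ, Nat.succ_injective⟩),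
      (fun n : ℕ => if n = 0 then -(x - degZero V s x) else f (n - 1)) n = 0 := by
    rw [Finset.sum_insert (by simp), Finset.sum_map, ← h, Finsupp.sum]
    simp
  have := eq_zero_of_sum_eigen (shift V 0 (fun j => 2 ^ s j)).toLinearMap one_ne_zero _ _ ?_ hs 0
    (Finset.mem_insert_self _ _)
  · rw [if_pos rfl, neg_eq_zero, sub_eq_zero] at this
    exact this.symm
  · intro n _
    rw [one_mul]
    refine mem_degPart.mp ?_
    split_ifs with h
    · rw [h]; exact neg_mem h0
    · have := hf (n - 1)
      rwa [Nat.sub_add_cancel (by omega)] at this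

/-- The shift by `s` is locally nilpotent on the elements without component in degree zero. -/
theorem exists_iterate_shift_eq_zero (s : V → ℕ) (x : QAlg V) :
    ∃ k, (shift V s 1)^[k] (x - degZero V s x) = 0 := by
  have mono : ∀ {y : QAlg V} {k : ℕ} (l : ℕ), (shift V s 1)^[k] y = 0 →
      (shift V s 1)^[l + k] y = 0 := by
    intro y k l h
    rw [Function.iterate_add_apply, h, iterate_map_zero]
  induction x using QAlg.induction with
  | h1 r => exact ⟨0, by simp⟩
  | hg j k =>
    refine ⟨k + 1, ?_⟩
    have e : ∀ (n : ℕ) (y : QAlg V), (shift V s 1)^[n] y = shift V (fun j => n * s j) 1 y := by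
      intro n
      induction n with
      | zero =>
        intro y
        have : (fun j => 0 * s j) = (0 : V → ℕ) := by ext; simp
        rw [this, shift_zero_one]
        rfl
      | succ n ih =>
        intro y
        rw [Function.iterate_succ_apply, ih, shift_shift, mul_one]
        congr 2
        ext j
        simp [Nat.succ_mul]
    rw [e, map_sub, degZero_gen, map_smul, shift_gen]
    rcases eq_or_ne (s j) 0 with h | h
    · simp [h]
    · rw [zero_pow h, zero_smul, sub_zero, if_neg]
      have := Nat.mul_le_mul_left (k + 1) (Nat.one_le_iff_ne_zero.mpr h)
      omega
  | hm x y hx hy =>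
    obtain ⟨k, hk⟩ := hx
    obtain ⟨l, hl⟩ := hy
    have e : x * y - degZero V s (x * y) =
        degZero V s x * (y - degZero V s y) + (x - degZero V s x) * y := by
      rw [map_mul]; noncomm_ring
    refine ⟨k + l, ?_⟩
    rw [e, iterate_map_add, iterate_map_mul, iterate_map_mul, mono k hl, add_comm k l, mono l hk,
      mul_zero, zero_mul, add_zero]
  | ha x y hx hy =>
    obtain ⟨k, hk⟩ := hx
    obtain ⟨l, hl⟩ := hy
    refine ⟨k + l, ?_⟩
    rw [map_add, add_sub_add_comm, iterate_map_add, mono k hl, add_comm k l, mono l hk, add_zero]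

/-- A linear map that shifts the degrees: homogeneous elements of its image have homogeneous
preimages. -/
theorem exists_mem_degPart_of_map {M : Type*} [AddCommGroup M] [Module ℚ M] (s : V → ℕ)
    (φ : Module.End ℚ M) (f : QAlg V →ₗ[ℚ] M) {c : ℚ} (hc : c ≠ 0)
    (hf : ∀ x, φ (f x) = c • f (shift V 0 (fun j => 2 ^ s j) x)) {m : ℕ} (y : QAlg V)
    (hy : φ (f y) = (c * 2 ^ m) • f y) : ∃ y' ∈ degPart s m, f y' = f y := by
  obtain ⟨S, g, hg, h⟩ := exists_degPart_decomposition s y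
  have h' : ∀ n, φ (f (g n)) = (c * 2 ^ n) • f (g n) := fun n => by
    rw [hf, mem_degPart.mp (hg n), map_smul, smul_smul]
  have hs : ∑ n ∈ insert m S,
      ((if n ∈ S then f (g n) else 0) - if n = m then f y else 0) = 0 := by
    rw [Finset.sum_sub_distrib, Finset.sum_ite_eq' _ m, if_pos (Finset.mem_insert_self _ _),
      Finset.sum_ite_mem, Finset.inter_eq_right.mpr (Finset.subset_insert m S), ← map_sum, h,
      sub_self]
  have := eq_zero_of_sum_eigen φ hc _ _ (fun n _ => ?_) hs m (Finset.mem_insert_self _ _)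
  · rw [if_pos rfl, sub_eq_zero] at this
    split_ifs at this
    · exact ⟨g m, hg m, this⟩
    · exact ⟨0, zero_mem _, by rw [map_zero, this]⟩
  · rw [map_sub, smul_sub]
    congr 1
    · split_ifs
      · exact h' n
      · simp
    · split_ifs with hn
      · rw [hn, hy]
      · simp

end Grading

/-! ### Faithfulness of the vertex operators -/

section Faithful

variable {V : Type u} [Quiver.{v} V] [Finite V]

/-- Injectivity in each degree. The shift by all vertices at once is locally nilpotent, so it
suffices to treat elements that the shift by one vertex `c` kills. These are multiples of
`e_{c,0}`, which reduces the degree. -/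
theorem toFock_eq_zero_of_degPart (hV : IsSymmetric V) (n : ℕ) (x : QAlg V)
    (hx : x ∈ degPart 1 n) (h : toFock hV x = 0) : x = 0 := by
  have hsh : ∀ (s : V → ℕ) (y : QAlg V), toFock hV y = 0 → toFock hV (shift V s 1 y) = 0 := by
    intro s y hy
    have := fockShift_toFock hV s 1 y
    rw [hy, map_zero] at this
    rw [this]
    congr 3
  induction n generalizing x with
  | zero =>
    have e : ∀ y, ∃ r : ℚ, degZero V 1 y = algebraMap ℚ _ r := by
      intro y
      induction y using QAlg.induction with
      | h1 r => exact ⟨r, AlgHom.commutes _ _⟩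
      | hg j k => exact ⟨0, by simp [degZero_gen]⟩
      | hm x y hx hy =>
        obtain ⟨a, ha⟩ := hx
        obtain ⟨b, hb⟩ := hy
        exact ⟨a * b, by rw [map_mul, ha, hb, map_mul]⟩
      | ha x y hx hy =>
        obtain ⟨a, ha⟩ := hx
        obtain ⟨b, hb⟩ := hy
        exact ⟨a + b, by rw [map_add, ha, hb, map_add]⟩
    obtain ⟨r, hr⟩ := e x
    rw [degZero_eq_self hx] at hr
    rw [hr, toFock_apply, AlgHom.commutes, Module.algebraMap_end_apply, smul_eq_zero] at h
    rw [hr, h.resolve_right one_ne_zero, map_zero]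
  | succ n ih =>
    classical
    have := Fintype.ofFinite V
    -- shifts of single vertices are injective on `x` by the inductive hypothesis
    have step : ∀ (c : V) (y : QAlg V), y ∈ degPart 1 (n + 1) → toFock hV y = 0 →
        shift V (Pi.single c 1) 1 y = 0 → y = 0 := by
      intro c y hy h0 h1
      obtain ⟨w, rfl⟩ := exists_eq_gen_mul c h1
      obtain ⟨w', hw', hww⟩ := exists_mem_degPart_of_map 1
        (shift V 0 (fun j => 2 ^ (1 : V → ℕ) j)).toLinearMap
        (LinearMap.mulLeft ℚ (gen V c 0)) two_ne_zero (m := n) (fun z => by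
          simp [shift_gen]) w (by
          rw [mem_degPart] at hy
          rw [LinearMap.mulLeft_apply, AlgHom.toLinearMap_apply, hy, pow_succ'])
      simp only [LinearMap.mulLeft_apply] at hww
      rw [← hww] at h0 ⊢
      rw [toFock_gen_zero_mul, mul_eq_zero] at h0
      have h2 := ih _ (shift_mem_degPart _ _ hw') (h0.resolve_left (MvPolynomial.X_ne_zero _))
      refine gen_zero_mul_eq_zero c (shift_one_eq_zero (fun j => ?_) h2)
      have : cocycle V c j ≠ 0 := left_ne_zero_of_mul_eq_one (cocycle_mul_self c j)
      simp [this]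
    have all : ∀ (S : Finset V) (y : QAlg V), y ∈ degPart 1 (n + 1) → toFock hV y = 0 →
        shift V (fun j => if j ∈ S then 1 else 0) 1 y = 0 → y = 0 := by
      intro S
      induction S using Finset.induction_on with
      | empty =>
        intro y _ _ h
        simpa using (shift_zero_one y).symm.trans h
      | insert c S hc ihS =>
        intro y hy h0 h1
        refine step c y hy h0 (ihS _ (shift_mem_degPart _ _ hy) (hsh _ _ h0) ?_)
        rw [shift_shift, mul_one]
        convert h1 using 3
        ext j
        rcases eq_or_ne j c with rfl | hj
        · simp [hc]
        · simp [hj]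
    obtain ⟨k, hk⟩ := exists_iterate_shift_eq_zero (1 : V → ℕ) x
    rw [degZero_eq_zero (Nat.succ_ne_zero n) hx, sub_zero] at hk
    induction k generalizing x with
    | zero => exact hk
    | succ k ihk =>
      refine all Finset.univ x hx h ?_
      simp only [Finset.mem_univ, if_true]
      exact ihk _ (shift_mem_degPart _ _ hx) (hsh _ _ h) hk

/-- The vector `1` is separating for the representation by vertex operators. -/
theorem toFock_injective (hV : IsSymmetric V) : Function.Injective (toFock hV) := by
  rw [injective_iff_map_eq_zero]
  intro x hx
  obtain ⟨S, g, hg, rfl⟩ := exists_degPart_decomposition 1 x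
  rw [map_sum] at hx
  refine Finset.sum_eq_zero fun n hn => toFock_eq_zero_of_degPart hV n _ (hg n) ?_
  refine eq_zero_of_sum_eigen (fockShift (0 : V → ℕ) (fun _ => 2)).toLinearMap one_ne_zero S _
    (fun n _ => ?_) hx n hn
  rw [AlgHom.toLinearMap_apply, fockShift_toFock, one_mul, ← map_smul, ← mem_degPart.mp (hg n)]
  simp

/-- The annihilator of `e_{c,0}` is the kernel of the shift `e_j(z) ↦ z^(m_cj) e_j(z)`. -/
theorem gen_zero_mul_eq_zero_iff (hV : IsSymmetric V) (c : V) {x : QAlg V} :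
    gen V c 0 * x = 0 ↔ shift V (incidenceMatrix V c) 1 x = 0 := by
  refine ⟨fun h => ?_, gen_zero_mul_eq_zero c⟩
  have h1 := congrArg (toFock hV) h
  rw [map_zero, toFock_gen_zero_mul, mul_eq_zero] at h1
  refine shift_one_eq_zero (fun j => ?_) ((injective_iff_map_eq_zero _).mp (toFock_injective hV) _
    (h1.resolve_left (MvPolynomial.X_ne_zero _)))
  have : cocycle V c j ≠ 0 := left_ne_zero_of_mul_eq_one (cocycle_mul_self c j)
  simp [this]

end Faithful

/-! ### The differential -/

section Derivation

variable {W : Type u} [Quiver.{v} W]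

theorem parity_eq_shift (x : QAlg W) :
    parity W x = shift W 0 (fun j => (-1) ^ incidenceMatrix W j j) x := by
  have : parity W = shift W 0 (fun j => (-1) ^ incidenceMatrix W j j) :=
    QAlg.hom_ext fun j k => by rw [parity_gen, shift_gen]; simp
  exact DFunLike.congr_fun this x

/-- The series `e_A(z) * (d/dz)^m e_B(z)`, where `m` is the number of arrows from `A` to `B`:
its coefficients are the first ones that do not vanish in the algebra. -/
noncomputable def collision (A B : W) : (QAlg W)⟦X⟧ :=
  genSeries W A * (derivHom _)^[incidenceMatrix W A B] (genSeries W B)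

/-- Shifts act on `collision A B` as on a generating series: the factor `z^(t_B)` can be moved out
of the derivatives, because the terms with fewer derivatives vanish. -/
theorem map_shift_collision (A B : W) (t : W → ℕ) (w : W → ℚ) :
    PowerSeries.map (shift W t w : QAlg W →+* QAlg W) (collision A B) =
      (w A * w B) • (PowerSeries.X ^ (t A + t B) * collision A B) := by
  have h := (vanish_genSeries A B).mul_iterate_coord_pow_mul (derivHom_mul (R := QAlg W))
    derivHom_X mul_X_comm (t B) _ le_rfl
  rw [collision, map_mul, map_iterate_derivHom, map_shift_genSeries, map_shift_genSeries,
    iterate_map_rat_smul', smul_mul_smul_comm, mul_assoc, h, pow_add, mul_assoc]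

theorem shift_coeff_collision (A B : W) (t : W → ℕ) (w : W → ℚ) (k : ℕ) :
    shift W t w (PowerSeries.coeff k (collision A B)) =
      if t A + t B ≤ k then (w A * w B) • PowerSeries.coeff (k - (t A + t B)) (collision A B)
      else 0 := by
  change (shift W t w : QAlg W →+* QAlg W) _ = _
  rw [← PowerSeries.coeff_map, map_shift_collision]
  change (w A * w B) • PowerSeries.coeff k (PowerSeries.X ^ (t A + t B) * collision A B) = _
  rw [PowerSeries.coeff_X_pow_mul', smul_ite, smul_zero]

theorem gen_mul_coeff_collision (A B i : W) (k l : ℕ) :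
    gen W i k * PowerSeries.coeff l (collision A B) =
      (-1 : ℚ) ^ (incidenceMatrix W i i * (incidenceMatrix W A A + incidenceMatrix W B B)) •
        (PowerSeries.coeff l (collision A B) * gen W i k) := by
  rw [gen_mul, shift_coeff_collision]
  simp [mul_add, pow_add]

/-- With `collision A B` as the image of the generating series of a new vertex, the relations with
the other vertices are preserved. -/
theorem vanish_genSeries_collision (A B i : W) :
    Vanish (derivHom _) (genSeries W i) (collision A B)
      (incidenceMatrix W i A + incidenceMatrix W i B) := by
  refine Vanish.mul_iterate derivHom_mul (vanish_genSeries i A) (vanish_genSeries i B)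
    (vanish_genSeries A B) fun r => ?_
  refine ⟨(-1 : ℚ) ^ (incidenceMatrix W i i * incidenceMatrix W A A) •
    (derivHom _)^[r] (genSeries W A), ?_⟩
  rw [smul_mul_assoc]
  exact mul_iterate_derivHom_comm (fun k l => by simpa [genSeries] using gen_mul_gen i A k l) r

theorem collision_mul_iterate (A B i : W) (p : ℕ) :
    collision A B * (derivHom _)^[p] (genSeries W i) =
      (-1 : ℚ) ^ (incidenceMatrix W i i * (incidenceMatrix W A A + incidenceMatrix W B B)) •
        ((derivHom _)^[p] (genSeries W i) * collision A B) := by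
  refine mul_iterate_derivHom_comm (fun k l => ?_) p
  rw [genSeries, PowerSeries.coeff_mk, gen_mul_coeff_collision, smul_smul, ← mul_pow]
  simp

variable (A B s : W)

/-- The numerical relations between a new vertex `s` and the pair of vertices `A`, `B` that it
was unlinked from. -/
structure IsUnlinkingVertex : Prop where
  symm : IsSymmetric W
  ne_left : A ≠ s
  ne_right : B ≠ s
  old : ∀ i, i ≠ s → incidenceMatrix W i s = incidenceMatrix W i A + incidenceMatrix W i B
  new : incidenceMatrix W s s = incidenceMatrix W s A + incidenceMatrix W s B + 1

variable {A B s}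

theorem IsUnlinkingVertex.parity_eq (h : IsUnlinkingVertex A B s) :
    incidenceMatrix W s s = incidenceMatrix W A A + incidenceMatrix W B B +
      2 * incidenceMatrix W A B + 1 := by
  have h1 := h.old A h.ne_left
  have h2 := h.old B h.ne_right
  have h3 : incidenceMatrix W s A = incidenceMatrix W A s := h.symm.apply _ _
  have h4 : incidenceMatrix W s B = incidenceMatrix W B s := h.symm.apply _ _
  have h5 : incidenceMatrix W B A = incidenceMatrix W A B := h.symm.apply _ _
  have := h.new
  omega

variable (A B s) in
open Classical in
/-- The values of the differential on the generators. -/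
noncomputable def diffGen (j : W) (k : ℕ) : QAlg W :=
  if j = s then PowerSeries.coeff k (collision A B) else 0

variable (A B s) in
/-- The matrix `(P x, D x; 0, x)` for a generator `x`, where `P` is the parity and `D` the
differential. A map `D` is a derivation twisted by `P` if and only if these matrices depend
multiplicatively on `x`. -/
noncomputable def diffMatrix (j : W) (k : ℕ) : Matrix (Fin 2) (Fin 2) (QAlg W) :=
  !![(-1 : ℚ) ^ incidenceMatrix W j j • gen W j k, diffGen A B s j k; 0, gen W j k]

theorem mk_diffGen (j : W) [Decidable (j = s)] :
    PowerSeries.mk (diffGen A B s j) = if j = s then collision A B else 0 := by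
  ext n
  rw [PowerSeries.coeff_mk, diffGen]
  split_ifs <;> simp

/-- The supercommutation relations for the matrices that encode the differential. -/
theorem IsUnlinkingVertex.diffMatrix_comm (h : IsUnlinkingVertex A B s) (i j : W) (k l : ℕ) :
    diffMatrix A B s i k * diffMatrix A B s j l =
      (-1 : ℚ) ^ (incidenceMatrix W i i * incidenceMatrix W j j) •
        (diffMatrix A B s j l * diffMatrix A B s i k) := by
  have hs := h.parity_eq
  have h1 : (-1 : ℚ) ^ incidenceMatrix W s s =
      - (-1) ^ (incidenceMatrix W A A + incidenceMatrix W B B) := by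
    rw [hs, pow_succ, pow_add, pow_mul]; simp
  have key : (-1 : ℚ) ^ incidenceMatrix W i i • (gen W i k * diffGen A B s j l) +
      diffGen A B s i k * gen W j l =
      (-1 : ℚ) ^ (incidenceMatrix W i i * incidenceMatrix W j j) •
      ((-1 : ℚ) ^ incidenceMatrix W j j • (gen W j l * diffGen A B s i k) +
        diffGen A B s j l * gen W i k) := by
    unfold diffGen
    rcases Nat.even_or_odd (incidenceMatrix W A A + incidenceMatrix W B B) with h2 | h2 <;>
      rw [h2.neg_one_pow] at h1 <;> split_ifs with hj hi hi
    · subst hi hj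
      simp [gen_mul_coeff_collision, pow_mul, h1, h2.neg_one_pow, add_comm]
    · subst hj
      rcases Nat.even_or_odd (incidenceMatrix W i i) with h3 | h3 <;>
        simp [gen_mul_coeff_collision, pow_mul, h1, h2.neg_one_pow, h3.neg_one_pow]
    · subst hi
      rcases Nat.even_or_odd (incidenceMatrix W j j) with h3 | h3 <;>
        simp [gen_mul_coeff_collision, pow_mul, h1, h2.neg_one_pow, h3.neg_one_pow]
    · simp
    · subst hi hj
      simp [gen_mul_coeff_collision, pow_mul, h1, add_comm]
    · subst hj
      rcases Nat.even_or_odd (incidenceMatrix W i i) with h3 | h3 <;>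
        simp [gen_mul_coeff_collision, pow_mul, h1, h2.neg_one_pow, h3.neg_one_pow]
    · subst hi
      rcases Nat.even_or_odd (incidenceMatrix W j j) with h3 | h3 <;>
        simp [gen_mul_coeff_collision, pow_mul, h1, h2.neg_one_pow, h3.neg_one_pow]
    · simp
  ext p q
  fin_cases p <;> fin_cases q
  · simp only [diffMatrix, Matrix.mul_apply, Fin.sum_univ_two, Matrix.smul_apply]
    simp [gen_mul_gen i j, smul_smul]
    congr 1
    ring
  · simpa [diffMatrix, Matrix.mul_apply] using key
  · simp [diffMatrix, Matrix.mul_apply]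
  · simp [diffMatrix, Matrix.mul_apply, gen_mul_gen i j]

/-- The differential of the quadratic relations. For `i = j = s` and `p = m_ss - 1` the two
summands do not vanish separately: they cancel. -/
theorem IsUnlinkingVertex.diffGen_vanish (h : IsUnlinkingVertex A B s) (i j : W) (p : ℕ)
    (hp : p < incidenceMatrix W i j) :
    (-1 : ℚ) ^ incidenceMatrix W i i •
        (genSeries W i * (derivHom _)^[p] (PowerSeries.mk (diffGen A B s j))) +
      PowerSeries.mk (diffGen A B s i) * (derivHom _)^[p] (genSeries W j) = 0 := by
  classical
  rw [mk_diffGen, mk_diffGen]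
  -- the part of the second summand below the order of vanishing
  have low : ∀ j, p < incidenceMatrix W j A + incidenceMatrix W j B →
      collision A B * (derivHom _)^[p] (genSeries W j) = 0 := fun j hj => by
    rw [collision_mul_iterate]
    have := (vanish_genSeries_collision A B j).iterate_mul_iterate_eq_zero derivHom_mul p 0 hj
    rw [Function.iterate_zero, id_eq] at this
    rw [this, smul_zero]
  split_ifs with hj hi hi
  · subst hj hi
    rw [h.new] at hp
    rcases Nat.lt_succ_iff_lt_or_eq.mp hp with hp | hp
    · rw [low _ hp, vanish_genSeries_collision A B _ p hp, smul_zero, add_zero]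
    · have := (vanish_genSeries_collision A B i).iterate_mul_iterate derivHom_mul p 0 hp
      rw [Function.iterate_zero, id_eq, ← hp] at this
      -- the signs: `|c| |e_s|` is even, and `m_ss = p + 1`
      have h1 : (-1 : ℚ) ^ (incidenceMatrix W i i *
          (incidenceMatrix W A A + incidenceMatrix W B B)) = 1 := by
        rw [Even.neg_one_pow]
        rw [h.parity_eq, Nat.even_mul, Nat.even_add_one, Nat.even_add]
        simp only [even_two, Even.mul_right, iff_true]
        tauto
      rw [collision_mul_iterate, h1, one_smul, this, h.new, ← hp, pow_succ]
      rcases Nat.even_or_odd p with hq | hq <;> simp [hq.neg_one_pow]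
  · subst hj
    rw [vanish_genSeries_collision A B _ p (h.old i hi ▸ hp), smul_zero, zero_mul, add_zero]
  · subst hi
    have hs : incidenceMatrix W i j = incidenceMatrix W j i := h.symm.apply _ _
    rw [low j (by rw [← h.old j hj, ← hs]; exact hp), iterate_map_zero, mul_zero, smul_zero,
      add_zero]
  · rw [iterate_map_zero, mul_zero, smul_zero, zero_mul, add_zero]

theorem IsUnlinkingVertex.diffMatrix_vanish (h : IsUnlinkingVertex A B s) (i j : W) :
    Vanish (derivHom _) (PowerSeries.mk (diffMatrix A B s i))
      (PowerSeries.mk (diffMatrix A B s j)) (incidenceMatrix W i j) := by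
  intro p hp
  have h0 := vanish_genSeries i j p hp
  have h1 := h.diffGen_vanish i j p hp
  ext1 n
  replace h0 := congrArg (PowerSeries.coeff n) h0
  replace h1 := congrArg (PowerSeries.coeff n) h1
  rw [genSeries, genSeries] at h0 h1
  have e : ∀ (c : ℚ) (f : (QAlg W)⟦X⟧), PowerSeries.coeff n (c • f) = c • PowerSeries.coeff n f :=
    fun _ _ => rfl
  rw [map_add, e, coeff_mul_iterate_derivHom, coeff_mul_iterate_derivHom, Finset.smul_sum,
    ← Finset.sum_add_distrib, map_zero] at h1
  rw [coeff_mul_iterate_derivHom, map_zero] at h0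
  rw [coeff_mul_iterate_derivHom, map_zero]
  ext a b
  rw [Matrix.sum_apply]
  fin_cases a <;> fin_cases b
  · have h2 := congrArg (fun x => ((-1 : ℚ) ^ incidenceMatrix W i i *
      (-1 : ℚ) ^ incidenceMatrix W j j) • x) h0
    simp only [smul_zero, Finset.smul_sum] at h2
    simp only [Matrix.zero_apply, ← h2]
    refine Finset.sum_congr rfl fun q _ => ?_
    simp [diffMatrix, smul_smul, mul_comm]
  · simp only [Matrix.zero_apply, ← h1]
    refine Finset.sum_congr rfl fun q _ => ?_
    simp [diffMatrix, smul_smul, mul_comm]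
  · refine Finset.sum_eq_zero fun q _ => ?_
    simp [diffMatrix]
  · simp only [Matrix.zero_apply, ← h0]
    refine Finset.sum_congr rfl fun q _ => ?_
    simp [diffMatrix]

end Derivation

section Differential

variable {W : Type u} [Quiver.{v} W] {A B s : W} (h : IsUnlinkingVertex A B s)

/-- The homomorphism `x ↦ (P x, D x; 0, x)` that encodes the differential. -/
noncomputable def diffHom : QAlg W →ₐ[ℚ] Matrix (Fin 2) (Fin 2) (QAlg W) :=
  lift (diffMatrix A B s) h.diffMatrix_comm h.diffMatrix_vanish

theorem diffHom_apply (x : QAlg W) :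
    diffHom h x 0 0 = parity W x ∧ diffHom h x 1 0 = 0 ∧ diffHom h x 1 1 = x := by
  induction x using QAlg.induction with
  | h1 r => rw [AlgHom.commutes, AlgHom.commutes]; simp [Matrix.algebraMap_matrix_apply]
  | hg j k =>
    rw [diffHom, lift_gen, parity_gen]
    simp [diffMatrix]
  | hm x y hx hy =>
    rw [map_mul, map_mul]
    simp only [Matrix.mul_apply, Fin.sum_univ_two, hx, hy]
    simp
  | ha x y hx hy =>
    rw [map_add, map_add]
    simp [hx, hy]

/-- The odd derivation with `e_s(z) ↦ e_A(z) * (d/dz)^m e_B(z)`, where `m` is the number of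
arrows from `A` to `B`, that kills the other generators. -/
noncomputable def diff : QAlg W →ₗ[ℚ] QAlg W where
  toFun x := diffHom h x 0 1
  map_add' x y := by rw [map_add, Matrix.add_apply]
  map_smul' c x := by rw [map_smul, Matrix.smul_apply, RingHom.id_apply]

theorem diff_apply (x : QAlg W) : diff h x = diffHom h x 0 1 := rfl

theorem diff_mul (x y : QAlg W) : diff h (x * y) = diff h x * y + parity W x * diff h y := by
  change diffHom h (x * y) 0 1 = diffHom h x 0 1 * y + _ * diffHom h y 0 1
  rw [map_mul, Matrix.mul_apply, Fin.sum_univ_two, (diffHom_apply h x).1, (diffHom_apply h y).2.2,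
    add_comm]

theorem diff_gen_self (k : ℕ) : diff h (gen W s k) = PowerSeries.coeff k (collision A B) := by
  rw [diff_apply, diffHom, lift_gen]
  simp [diffMatrix, diffGen]

theorem diff_gen_of_ne {j : W} (hj : j ≠ s) (k : ℕ) : diff h (gen W j k) = 0 := by
  rw [diff_apply, diffHom, lift_gen]
  simp [diffMatrix, diffGen, hj]

theorem diff_gen_mul (j : W) (hj : j ≠ s) (k : ℕ) (x : QAlg W) :
    diff h (gen W j k * x) = (-1 : ℚ) ^ incidenceMatrix W j j • (gen W j k * diff h x) := by
  rw [diff_mul, diff_gen_of_ne h hj, zero_mul, zero_add, parity_gen, smul_mul_assoc]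

theorem diff_coeff_collision (k : ℕ) : diff h (PowerSeries.coeff k (collision A B)) = 0 := by
  rw [collision, genSeries, genSeries, coeff_mul_iterate_derivHom, map_sum]
  refine Finset.sum_eq_zero fun q _ => ?_
  rw [map_smul, diff_gen_mul h A h.ne_left, diff_gen_of_ne h h.ne_right, mul_zero, smul_zero,
    smul_zero]

/-- The differential commutes with the shifts that are compatible with
`e_s(z) ↦ e_A(z) * (d/dz)^m e_B(z)`. -/
theorem diff_shift {t : W → ℕ} {w : W → ℚ} (ht : t s = t A + t B) (hw : w s = w A * w B)
    (x : QAlg W) : diff h (shift W t w x) = shift W t w (diff h x) := by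
  have := QAlg.skew_ext (D := diff h ∘ₗ (shift W t w).toLinearMap)
    (E := (shift W t w).toLinearMap ∘ₗ diff h) (L := (parity W).comp (shift W t w))
    (R := shift W t w) (fun x y => by simp [diff_mul])
    (fun x y => by
      have := shift_comm t 0 w (fun j => (-1) ^ incidenceMatrix W j j) x
      rw [← parity_eq_shift, ← parity_eq_shift] at this
      simp [diff_mul, this]) (fun j k => by
      rcases eq_or_ne j s with rfl | hj
      · simp only [LinearMap.comp_apply, AlgHom.toLinearMap_apply, diff_gen_self,
          shift_coeff_collision, shift_gen, ht, hw]
        split_ifs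
        · rw [map_smul, diff_gen_self]
        · rw [map_zero]
      · simp only [LinearMap.comp_apply, AlgHom.toLinearMap_apply, diff_gen_of_ne h hj, shift_gen,
          map_zero]
        split_ifs
        · rw [map_smul, diff_gen_of_ne h hj, smul_zero]
        · rw [map_zero])
  exact DFunLike.congr_fun this x

theorem parity_diff (x : QAlg W) : parity W (diff h x) = -diff h (parity W x) := by
  have := QAlg.skew_ext (D := (parity W).toLinearMap ∘ₗ diff h)
    (E := -(diff h ∘ₗ (parity W).toLinearMap)) (L := (parity W).comp (parity W))
    (R := parity W) (fun x y => by simp [diff_mul])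
    (fun x y => by simp [diff_mul, add_comm]) (fun j k => by
      simp only [LinearMap.comp_apply, AlgHom.toLinearMap_apply, LinearMap.neg_apply, parity_gen,
        map_smul]
      rcases eq_or_ne j s with rfl | hj
      · rw [diff_gen_self, parity_eq_shift, shift_coeff_collision, h.parity_eq]
        simp [pow_add, pow_mul]
      · rw [diff_gen_of_ne h hj, map_zero, smul_zero, neg_zero])
  exact DFunLike.congr_fun this x

theorem diff_isOddDerivation : IsOddDerivation W (diff h) where
  odd p x hx := by
    change _ = _ at hx
    change _ = _
    rw [parity_diff, hx, map_smul, pow_succ, mul_neg_one, neg_smul]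
  leibniz p x y hx := by
    change _ = _ at hx
    rw [diff_mul, hx, smul_mul_assoc]

theorem diff_diff (x : QAlg W) : diff h (diff h x) = 0 := by
  have := QAlg.skew_ext (D := diff h ∘ₗ diff h) (E := 0) (L := AlgHom.id ℚ _)
    (R := AlgHom.id ℚ _) (fun x y => by
      simp [diff_mul, parity_diff, parity_parity]) (fun x y => by simp) (fun j k => by
      rcases eq_or_ne j s with rfl | hj
      · simp [diff_gen_self, diff_coeff_collision]
      · simp [diff_gen_of_ne h hj])
  exact DFunLike.congr_fun this x

end Differential

section Homogeneous

variable {V : Type u} [Quiver.{v} V] {s : V → ℕ} {n : ℕ} {x : QAlg V}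

theorem exists_eq_gen_mul_of_mem_degPart [DecidableEq V] {c : V} (hc : s c = 1)
    (hx : x ∈ degPart s (n + 1)) (h : shift V (Pi.single c 1) 1 x = 0) :
    ∃ y ∈ degPart s n, x = gen V c 0 * y := by
  obtain ⟨y, rfl⟩ := exists_eq_gen_mul c h
  obtain ⟨y', hy', e⟩ := exists_mem_degPart_of_map s (shift V 0 (fun j => 2 ^ s j)).toLinearMap
    (LinearMap.mulLeft ℚ (gen V c 0)) two_ne_zero (m := n) (fun z => by simp [shift_gen, hc]) y (by
    rw [mem_degPart] at hx
    rw [LinearMap.mulLeft_apply, AlgHom.toLinearMap_apply, hx, pow_succ'])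
  exact ⟨y', hy', e.symm⟩

theorem exists_shift_eq_of_mem_degPart (t : V → ℕ) (hx : x ∈ degPart s n) :
    ∃ y ∈ degPart s n, shift V t 1 y = x := by
  obtain ⟨y, rfl⟩ := shift_surjective t x
  exact exists_mem_degPart_of_map s (shift V 0 (fun j => 2 ^ s j)).toLinearMap
    (shift V t 1).toLinearMap one_ne_zero (m := n)
    (fun z => by rw [one_smul]; exact shift_comm _ _ _ _ _) y
    (by rw [one_mul]; exact mem_degPart.mp hx)

theorem diff_mem_degPart {A B S : V} (h : IsUnlinkingVertex A B S)
    (hs : s S = s A + s B) (hx : x ∈ degPart s n) : diff h x ∈ degPart s n := by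
  rw [mem_degPart] at *
  rw [← diff_shift h rfl (by rw [hs, pow_add]), hx, map_smul]

theorem exists_diff_eq_of_mem_degPart {A B S : V} (h : IsUnlinkingVertex A B S)
    (hs : s S = s A + s B) (hx : x ∈ degPart s n) (hy : ∃ y, diff h y = x) :
    ∃ y ∈ degPart s n, diff h y = x := by
  obtain ⟨y, rfl⟩ := hy
  exact exists_mem_degPart_of_map s (shift V 0 (fun j => 2 ^ s j)).toLinearMap
    (diff h) one_ne_zero (m := n)
    (fun z => by rw [one_smul]; exact (diff_shift h rfl (by rw [hs, pow_add]) _).symm) y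
    (by rw [one_mul]; exact mem_degPart.mp hx)

end Homogeneous

/-! ### The unlinked quiver -/

section Unlinked

variable {V : Type u} [Quiver.{v} V] {a b : V}

open Classical in
theorem incidenceMatrix_vertex_vertex (i j : V) : incidenceMatrix (Unlinked V a b) (.vertex i)
    (.vertex j) = if (i = a ∧ j = b) ∨ (i = b ∧ j = a) then incidenceMatrix V i j - 1
      else incidenceMatrix V i j := by
  rw [incidenceMatrix_unlinked]
  rfl

theorem incidenceMatrix_vertex_le (i j : V) :
    incidenceMatrix (Unlinked V a b) (.vertex i) (.vertex j) ≤ incidenceMatrix V i j := by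
  classical
  rw [incidenceMatrix_vertex_vertex]
  split_ifs <;> omega

theorem incidenceMatrix_left_right : incidenceMatrix (Unlinked V a b) (.vertex a) (.vertex b) =
    incidenceMatrix V a b - 1 := by
  classical
  rw [incidenceMatrix_vertex_vertex, if_pos (Or.inl ⟨rfl, rfl⟩)]

variable (hQ : IsSymmetric V) (hab : a ≠ b) (hm : 0 < incidenceMatrix V a b)
include hQ hab hm

theorem isUnlinkingVertex_star :
    IsUnlinkingVertex (W := Unlinked V a b) (.vertex a) (.vertex b) .star := by
  have hs : ∀ i j, incidenceMatrix V i j = incidenceMatrix V j i := fun i j => hQ.apply j i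
  refine ⟨?_, by simp, by simp, ?_, ?_⟩
  · rw [IsSymmetric, incidenceMatrix_unlinked]
    refine Matrix.IsSymm.ext fun i j => ?_
    rcases i with i | _ <;> rcases j with j | _ <;> simp only [unlinkedMatrix]
    rw [hs i j]
    congr 1
    simp only [eq_iff_iff]
    tauto
  · intro i hi
    rcases i with i | _
    · rw [incidenceMatrix_unlinked]
      simp only [unlinkedMatrix]
      have h1 := hs a b
      rcases eq_or_ne i a with rfl | ha
      · simp [hab, hab.symm]; omega
      · rcases eq_or_ne i b with rfl | hb
        · simp [hab, hab.symm]; omega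
        · simp [ha, hb]
    · exact absurd rfl hi
  · rw [incidenceMatrix_unlinked]
    simp only [unlinkedMatrix, if_true, if_neg hab.symm]
    omega

open Classical in
/-- The relation between the incidence numbers of the two quivers that makes the homology
computation work: composing the shifts by the rows of `b` in the old quiver and of `a` in the new
one gives the shift by the row of `star`, up to one more shift at `a`. -/
theorem incidenceMatrix_add_row (i : V) : incidenceMatrix V b i +
    incidenceMatrix (Unlinked V a b) (.vertex a) (.vertex i) =
    incidenceMatrix (Unlinked V a b) .star (.vertex i) + (if i = a then 1 else 0) := by
  classical
  have hs : ∀ i j, incidenceMatrix V i j = incidenceMatrix V j i := fun i j => hQ.apply j i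
  have h1 := hs a b
  rw [incidenceMatrix_unlinked]
  simp only [unlinkedMatrix]
  rcases eq_or_ne i a with rfl | ha
  · simp [hab]; omega
  · rcases eq_or_ne i b with rfl | hb
    · simp [hab.symm]; omega
    · simp [ha, hb, hs i a, hs i b, add_comm]

omit hQ hm

theorem incidenceMatrix_vertex_self (i : V) :
    incidenceMatrix (Unlinked V a b) (.vertex i) (.vertex i) = incidenceMatrix V i i := by
  classical
  rw [incidenceMatrix_vertex_vertex, if_neg]
  rintro (⟨rfl, h⟩ | ⟨rfl, h⟩)
  · exact hab h
  · exact hab h.symm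

/-- The projection `A_{Q'} → A_Q` from the algebra of the unlinked quiver that kills the
generators of the new vertex. -/
noncomputable def unlinkedProj : QAlg (Unlinked V a b) →ₐ[ℚ] QAlg V :=
  lift (fun j k => match j with
      | .vertex i => gen V i k
      | .star => 0)
    (by
      rintro (i | _) (j | _) k l
      · simp only [incidenceMatrix_vertex_self hab]
        exact gen_mul_gen i j k l
      all_goals simp)
    (by
      have h0 : (PowerSeries.mk fun _ : ℕ => (0 : QAlg V)) = 0 := by ext; simp
      rintro (i | _) (j | _)
      · exact (vanish_genSeries i j).mono (incidenceMatrix_vertex_le i j)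
      all_goals intro p _
      all_goals simp [h0])

theorem unlinkedProj_vertex (i : V) (k : ℕ) :
    unlinkedProj hab (gen (Unlinked V a b) (.vertex i) k) = gen V i k := lift_gen _ _ _ _ _

theorem unlinkedProj_star (k : ℕ) :
    unlinkedProj hab (gen (Unlinked V a b) .star k) = 0 := lift_gen _ _ _ _ _

theorem map_unlinkedProj_vertex (i : V) : PowerSeries.map
    (unlinkedProj hab : QAlg (Unlinked V a b) →+* QAlg V) (genSeries _ (.vertex i)) =
    genSeries V i := by
  ext n
  simp [genSeries, unlinkedProj_vertex]

theorem unlinkedProj_shift (t : Unlinked V a b → ℕ) (w : Unlinked V a b → ℚ)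
    (x : QAlg (Unlinked V a b)) : unlinkedProj hab (shift _ t w x) =
      shift V (fun i => t (.vertex i)) (fun i => w (.vertex i)) (unlinkedProj hab x) := by
  have : (unlinkedProj hab).comp (shift _ t w) =
      (shift V (fun i => t (.vertex i)) (fun i => w (.vertex i))).comp (unlinkedProj hab) := by
    refine QAlg.hom_ext ?_
    rintro (i | _) k
    · simp only [AlgHom.comp_apply, unlinkedProj_vertex, shift_gen]
      split_ifs
      · rw [map_smul, unlinkedProj_vertex]
      · rw [map_zero]
    · simp only [AlgHom.comp_apply, unlinkedProj_star, shift_gen, map_zero]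
      split_ifs
      · rw [map_smul, unlinkedProj_star, smul_zero]
      · rw [map_zero]
  exact DFunLike.congr_fun this x

include hm in
theorem unlinkedProj_collision (k : ℕ) : unlinkedProj hab (PowerSeries.coeff k
    (collision (W := Unlinked V a b) (.vertex a) (.vertex b))) = 0 := by
  change (unlinkedProj hab : QAlg (Unlinked V a b) →+* QAlg V) _ = _
  rw [← PowerSeries.coeff_map, collision, map_mul, map_iterate_derivHom, map_unlinkedProj_vertex,
    map_unlinkedProj_vertex, incidenceMatrix_left_right, vanish_genSeries a b _ (by omega),
    map_zero]

variable (V a b) in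
/-- The weight that counts the generators of the new vertex. -/
def starWeight : Unlinked V a b → ℕ
  | .vertex _ => 0
  | .star => 1

theorem unlinkedProj_degZero (x : QAlg (Unlinked V a b)) :
    unlinkedProj hab (degZero _ (starWeight V a b) x) = unlinkedProj hab x := by
  have h1 : (fun i : V => (0 : ℚ) ^ starWeight V a b (.vertex i)) = 1 := by
    ext; simp [starWeight]
  rw [degZero, unlinkedProj_shift, h1]
  exact shift_zero_one _

variable (h : IsUnlinkingVertex (W := Unlinked V a b) (.vertex a) (.vertex b) .star)
include h

include hm in
theorem unlinkedProj_diff (x : QAlg (Unlinked V a b)) : unlinkedProj hab (diff h x) = 0 := by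
  have := QAlg.skew_ext (D := (unlinkedProj hab).toLinearMap ∘ₗ diff h) (E := 0)
    (L := (unlinkedProj hab).comp (parity _)) (R := unlinkedProj hab)
    (fun x y => by simp [diff_mul]) (fun x y => by simp) (by
      rintro (i | _) k
      · simp [diff_gen_of_ne h]
      · simp [diff_gen_self, unlinkedProj_collision hab hm])
  exact DFunLike.congr_fun this x

omit hab in
/-- Elements without generators of the new vertex are cycles. -/
theorem diff_degZero (x : QAlg (Unlinked V a b)) :
    diff h (degZero _ (starWeight V a b) x) = 0 := by
  have := QAlg.skew_ext (D := diff h ∘ₗ (degZero _ (starWeight V a b)).toLinearMap) (E := 0)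
    (L := (parity _).comp (degZero _ (starWeight V a b))) (R := degZero _ (starWeight V a b))
    (fun x y => by simp [diff_mul]) (fun x y => by simp) (by
      rintro (i | _) k
      · simp [degZero_gen, starWeight, diff_gen_of_ne h]
      · simp [degZero_gen, starWeight])
  exact DFunLike.congr_fun this x

omit hab in
/-- The defining relations of `A_Q` hold in the algebra of the unlinked quiver up to
boundaries. -/
theorem exists_diff_eq_relation (i j : V) (p : ℕ) (hp : p < incidenceMatrix V i j) (n : ℕ) :
    ∃ w, diff h w = PowerSeries.coeff n (genSeries (Unlinked V a b) (.vertex i) *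
      (derivHom _)^[p] (genSeries _ (.vertex j))) := by
  classical
  by_cases hp' : p < incidenceMatrix (Unlinked V a b) (.vertex i) (.vertex j)
  · exact ⟨0, by rw [vanish_genSeries _ _ p hp', map_zero, map_zero]⟩
  have hp0 : p = incidenceMatrix (Unlinked V a b) (.vertex i) (.vertex j) := by
    rw [incidenceMatrix_vertex_vertex] at hp' ⊢
    split_ifs at hp' ⊢ <;> omega
  have hij : (i = a ∧ j = b) ∨ (i = b ∧ j = a) := by
    by_contra hne
    rw [incidenceMatrix_vertex_vertex, if_neg hne] at hp'
    exact hp' hp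
  rcases hij with ⟨rfl, rfl⟩ | ⟨rfl, rfl⟩
  · exact ⟨gen _ Unlinked.star n, by rw [diff_gen_self, collision, hp0]⟩
  · have hs : incidenceMatrix (Unlinked V j i) (.vertex i) (.vertex j) =
        incidenceMatrix (Unlinked V j i) (.vertex j) (.vertex i) := h.symm.apply _ _
    have h1 := (vanish_genSeries (V := Unlinked V j i) (.vertex j) (.vertex i)).iterate_mul_iterate
      derivHom_mul p 0 (by rw [hp0, hs, add_zero])
    rw [Function.iterate_zero, id_eq] at h1
    have h2 := mul_iterate_derivHom_comm (f := genSeries (Unlinked V j i) (.vertex i))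
      (g := genSeries (Unlinked V j i) (.vertex j)) (fun k l => by
        rw [genSeries, genSeries, PowerSeries.coeff_mk, PowerSeries.coeff_mk]
        exact gen_mul_gen _ _ _ _) p
    rw [h1, ← collision] at h2
    rw [h2]
    rcases Nat.even_or_odd p with he | he
    · rw [he.neg_one_pow, one_mul]
      exact ⟨_ • gen _ Unlinked.star n, by rw [map_smul, diff_gen_self]; rfl⟩
    · rw [he.neg_one_pow, neg_one_mul, smul_neg]
      exact ⟨-(_ • gen _ Unlinked.star n), by rw [map_neg, map_smul, diff_gen_self]; rfl⟩

/-- The homomorphism from `A_Q` to the homology of the algebra of the unlinked quiver. -/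
noncomputable def toHomology :
    QAlg V →ₐ[ℚ] Homology (diff_isOddDerivation h) (diff_diff h) :=
  lift (fun i k => homologyClass _ _ (gen (Unlinked V a b) (.vertex i) k)
      (diff_gen_of_ne h (by simp) k))
    (fun i j k l => by
      rw [homologyClass, homologyClass, ← map_mul, ← map_mul,
        ← incidenceMatrix_vertex_self hab i, ← incidenceMatrix_vertex_self hab j]
      change Ideal.Quotient.mkₐ ℚ _ _ = _ • Ideal.Quotient.mkₐ ℚ _ _
      rw [← map_smul]
      congr 1
      exact Subtype.ext (gen_mul_gen _ _ k l))
    (fun i j p hp => by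
      let c : V → ℕ → cycles (diff_isOddDerivation h) := fun i k =>
        ⟨gen (Unlinked V a b) (.vertex i) k, diff_gen_of_ne h (by simp) k⟩
      let q := Ideal.Quotient.mk (boundaries (diff_isOddDerivation h) (diff_diff h))
      have e : ∀ i, (PowerSeries.mk fun k => homologyClass (diff_isOddDerivation h) (diff_diff h)
          (gen (Unlinked V a b) (.vertex i) k) (diff_gen_of_ne h (by simp) k)) =
          PowerSeries.map q (PowerSeries.mk (c i)) := by
        intro i
        ext1 k
        rw [PowerSeries.coeff_map, PowerSeries.coeff_mk, PowerSeries.coeff_mk]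
        rfl
      rw [e, e, ← map_iterate_derivHom, ← map_mul]
      ext1 n
      rw [PowerSeries.coeff_map, map_zero]
      refine Ideal.Quotient.eq_zero_iff_mem.mpr ?_
      obtain ⟨w, hw⟩ := exists_diff_eq_relation h i j p hp n
      refine ⟨w, hw.trans ?_⟩
      change _ = ((cycles (diff_isOddDerivation h)).val :
        cycles (diff_isOddDerivation h) →+* QAlg (Unlinked V a b)) _
      rw [← PowerSeries.coeff_map, map_mul (PowerSeries.map _), map_iterate_derivHom]
      congr 2)

theorem toHomology_gen (i : V) (k : ℕ) : toHomology hab h (gen V i k) =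
    homologyClass _ _ (gen (Unlinked V a b) (.vertex i) k) (diff_gen_of_ne h (by simp) k) :=
  lift_gen _ _ _ _ _

/-- The composite `A_{Q'} → A_Q → H(A_{Q'})` is the class of the component of star-degree zero. -/
theorem toHomology_unlinkedProj (x : QAlg (Unlinked V a b)) :
    toHomology hab h (unlinkedProj hab x) =
      homologyClass _ _ (degZero _ (starWeight V a b) x) (diff_degZero h x) := by
  have : (toHomology hab h).comp (unlinkedProj hab) =
      (Ideal.Quotient.mkₐ ℚ (boundaries (diff_isOddDerivation h) (diff_diff h))).comp
        ((degZero _ (starWeight V a b)).codRestrict _ (diff_degZero h)) := by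
    refine QAlg.hom_ext ?_
    rintro (i | _) k
    · rw [AlgHom.comp_apply, unlinkedProj_vertex, toHomology_gen, AlgHom.comp_apply]
      refine congrArg (Ideal.Quotient.mk _) (Subtype.ext ?_)
      change _ = degZero _ _ _
      rw [degZero_gen]
      simp [starWeight]
    · rw [AlgHom.comp_apply, unlinkedProj_star, map_zero, AlgHom.comp_apply]
      refine (map_zero (Ideal.Quotient.mk _)).symm.trans
        (congrArg (Ideal.Quotient.mk _) (Subtype.ext ?_))
      change 0 = degZero _ _ _
      rw [degZero_gen]
      simp [starWeight]
  exact DFunLike.congr_fun this x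

/-- In star-degree zero, the kernel of the projection to `A_Q` consists of boundaries. -/
theorem exists_diff_eq_degZero {x : QAlg (Unlinked V a b)} (hx : unlinkedProj hab x = 0) :
    ∃ w, diff h w = degZero _ (starWeight V a b) x := by
  have := toHomology_unlinkedProj hab h x
  rw [hx, map_zero] at this
  exact Ideal.Quotient.eq_zero_iff_mem.mp this.symm

end Unlinked

/-! ### Acyclicity -/

section Acyclic

variable {V : Type u} [Quiver.{v} V] {a b : V}

open Classical in
variable (V a b) in
/-- The weight that counts the generators of the vertices `a` and `star`. The differential
preserves the corresponding degree. -/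
noncomputable def leftWeight : Unlinked V a b → ℕ :=
  Pi.single .star 1 + Pi.single (.vertex a) 1

omit [Quiver.{v} V] in
theorem leftWeight_star : leftWeight V a b .star = 1 := by
  simp [leftWeight]

omit [Quiver.{v} V] in
theorem leftWeight_left : leftWeight V a b (.vertex a) = 1 := by
  simp [leftWeight]

omit [Quiver.{v} V] in
theorem leftWeight_right (hab : a ≠ b) : leftWeight V a b (.vertex b) = 0 := by
  simp [leftWeight, hab.symm]

instance [Finite V] : Finite (Unlinked V a b) :=
  Finite.of_surjective (fun i : Option V => i.elim .star .vertex) (by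
    rintro (i | _)
    · exact ⟨some i, rfl⟩
    · exact ⟨none, rfl⟩)

variable [Finite V] (hQ : IsSymmetric V) (hab : a ≠ b) (hm : 0 < incidenceMatrix V a b)
  (h : IsUnlinkingVertex (W := Unlinked V a b) (.vertex a) (.vertex b) .star)

omit [Finite V] [Quiver.{v} V] in
include hab in
theorem leftWeight_eq_add : leftWeight V a b .star =
    leftWeight V a b (.vertex a) + leftWeight V a b (.vertex b) := by
  rw [leftWeight_star, leftWeight_left, leftWeight_right hab]

/-- A cycle `e_{a,0} u` over zero is a boundary, provided this holds for all cycles of lower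
degree. -/
theorem exists_diff_eq_gen_mul {n : ℕ}
    (ih : ∀ x ∈ degPart (leftWeight V a b) n, diff h x = 0 → unlinkedProj hab x = 0 →
      ∃ w, diff h w = x) {u : QAlg (Unlinked V a b)} (hu : u ∈ degPart (leftWeight V a b) n)
    (hD : diff h (gen _ (.vertex a) 0 * u) = 0)
    (hp : unlinkedProj hab (gen _ (.vertex a) 0 * u) = 0) :
    ∃ w, diff h w = gen _ (.vertex a) 0 * u := by
  set κ := degZero _ (starWeight V a b) with hκ
  obtain ⟨w₀, hw₀⟩ := exists_diff_eq_degZero hab h hp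
  have hκa : κ (gen _ (.vertex a) 0) = gen _ (.vertex a) 0 := by
    rw [hκ, degZero_gen]; simp [starWeight]
  rw [← hκ, map_mul, hκa] at hw₀
  have hD' : diff h (gen _ (.vertex a) 0 * (u - κ u)) = 0 := by
    rw [mul_sub, map_sub, hD, ← hw₀, diff_diff, sub_zero]
  rw [diff_gen_mul h _ h.ne_left, smul_eq_zero_iff_right (pow_ne_zero _ (by norm_num)),
    gen_zero_mul_eq_zero_iff h.symm, ← diff_shift h (h.old _ h.ne_left) (by simp)] at hD'
  have hκu : κ u ∈ degPart (leftWeight V a b) n := shift_mem_degPart _ _ hu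
  obtain ⟨w, hw⟩ := ih _ (shift_mem_degPart (incidenceMatrix (Unlinked V a b) (.vertex a)) 1
      (sub_mem hu hκu)) hD' (by
    rw [unlinkedProj_shift, map_sub, hκ, unlinkedProj_degZero, sub_self, map_zero])
  obtain ⟨w', rfl⟩ := shift_surjective (incidenceMatrix (Unlinked V a b) (.vertex a)) w
  rw [diff_shift h (h.old _ h.ne_left) (by simp), ← sub_eq_zero, ← map_sub,
    ← gen_zero_mul_eq_zero_iff h.symm, mul_sub, sub_eq_zero] at hw
  refine ⟨w₀ + (-1 : ℚ) ^ incidenceMatrix (Unlinked V a b) (.vertex a) (.vertex a) •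
    (gen _ (.vertex a) 0 * w'), ?_⟩
  rw [map_add, hw₀, map_smul, diff_gen_mul h _ h.ne_left, hw, smul_smul, ← mul_pow]
  simp [mul_sub]

/-- The value of the differential on `e_{s,0}`. -/
theorem coeff_zero_collision {W : Type*} [Quiver W] (A B : W) :
    PowerSeries.coeff 0 (collision A B) = ((incidenceMatrix W A B).factorial : ℚ) •
      (gen W A 0 * gen W B (incidenceMatrix W A B)) := by
  rw [collision, genSeries, genSeries, coeff_mul_iterate_derivHom]
  simp [Nat.one_ascFactorial]

include hQ hm in
/-- The inductive step for a cycle `x` that is killed by the shift of `a` and `star`. Then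
`x = e_{star,0} v + e_{a,0} u`, and the equation `D x = 0` shows that a shift of `v` is a cycle
over zero, to which the inductive hypothesis applies. -/
theorem exists_diff_eq_of_shift_eq_zero {n : ℕ}
    (ih : ∀ x ∈ degPart (leftWeight V a b) n, diff h x = 0 → unlinkedProj hab x = 0 →
      ∃ w, diff h w = x) {x : QAlg (Unlinked V a b)}
    (hx : x ∈ degPart (leftWeight V a b) (n + 1)) (hD : diff h x = 0)
    (hp : unlinkedProj hab x = 0) (hs : shift (Unlinked V a b) (leftWeight V a b) 1 x = 0) :
    ∃ w, diff h w = x := by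
  classical
  set M := incidenceMatrix (Unlinked V a b) with hM
  -- `e_{star,0} y` is a multiple of `e_{a,0}` if and only if the shift by `t` kills `y`
  set t : Unlinked V a b → ℕ := M .star + Pi.single (.vertex a) 1 with ht
  have htD : t .star = t (.vertex a) + t (.vertex b) := by
    have h1 : t .star = M .star .star := by simp [ht]
    have h2 : t (.vertex a) = M .star (.vertex a) + 1 := by simp [ht]
    have h3 : t (.vertex b) = M .star (.vertex b) := by simp [ht, hab.symm]
    rw [h1, h2, h3, hM, h.new]
    omega
  have hsplit : ∀ y, shift (Unlinked V a b) (leftWeight V a b) 1 y =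
      shift (Unlinked V a b) (Pi.single .star 1) 1
        (shift (Unlinked V a b) (Pi.single (.vertex a) 1) 1 y) := fun y => by
    rw [shift_shift, mul_one]
    rfl
  have ht_split : ∀ y, shift (Unlinked V a b) t 1 y = shift (Unlinked V a b) (M .star) 1
      (shift (Unlinked V a b) (Pi.single (.vertex a) 1) 1 y) := fun y => by
    rw [shift_shift, mul_one]
  -- `x = e_{star,0} v + e_{a,0} u`
  obtain ⟨v₁, hv₁, e₁⟩ := exists_eq_gen_mul_of_mem_degPart leftWeight_star
    (shift_mem_degPart (Pi.single (.vertex a) 1) 1 hx) ((hsplit x).symm.trans hs)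
  obtain ⟨v, hv, rfl⟩ := exists_shift_eq_of_mem_degPart (Pi.single (.vertex a) 1) hv₁
  have hgs : shift (Unlinked V a b) (Pi.single (.vertex a) 1) 1 (gen (Unlinked V a b) .star 0) =
      gen (Unlinked V a b) .star 0 := by
    simp [shift_gen]
  have hga : shift (Unlinked V a b) (Pi.single (.vertex a) 1) 1
      (gen (Unlinked V a b) (.vertex a) 0) = 0 := by
    simp [shift_gen]
  obtain ⟨u, e⟩ : ∃ u, x = gen (Unlinked V a b) .star 0 * v +
      gen (Unlinked V a b) (.vertex a) 0 * u := by
    obtain ⟨u, hu⟩ := exists_eq_gen_mul (.vertex a) (x := x - gen (Unlinked V a b) .star 0 * v) (by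
      rw [map_sub, e₁, map_mul, hgs, sub_self])
    exact ⟨u, by rw [← hu, add_sub_cancel]⟩
  -- `D x = 0` is the sum of a component at `e_{star,0}` and one at `e_{a,0}`
  set c : ℚ := ((M (.vertex a) (.vertex b)).factorial : ℚ) with hc
  have hDs : ∀ y, diff h (gen (Unlinked V a b) .star 0 * y) = gen (Unlinked V a b) (.vertex a) 0 *
        (c • (gen (Unlinked V a b) (.vertex b) (M (.vertex a) (.vertex b)) * y)) +
      (-1 : ℚ) ^ M .star .star • (gen (Unlinked V a b) .star 0 * diff h y) := fun y => by
    rw [diff_mul, diff_gen_self, coeff_zero_collision, parity_gen, smul_mul_assoc, smul_mul_assoc,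
      mul_assoc, mul_smul_comm]
  have hDx := hD
  rw [e, map_add, hDs, diff_gen_mul h (.vertex a) h.ne_left] at hDx
  have hcyc : diff h (shift (Unlinked V a b) t 1 v) = 0 := by
    have := congrArg (shift (Unlinked V a b) (Pi.single (.vertex a) 1) 1) hDx
    simp only [map_add, map_mul, map_smul, map_zero, hga, hgs, zero_mul, zero_add, smul_zero,
      add_zero] at this
    rw [smul_eq_zero_iff_right (pow_ne_zero _ (by norm_num)), gen_zero_mul_eq_zero_iff h.symm,
      ← ht_split, ← diff_shift h htD (by simp)] at this
    exact this
  -- the component of star-degree zero is `e_{a,0} e_{b,m} v` up to a boundary; in `A_Q` the shift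
  -- by the row of `a` turns `e_{b,m}` into `e_{b,0}`
  have hproj : unlinkedProj hab (shift (Unlinked V a b) t 1 v) = 0 := by
    have h1 := congrArg (degZero _ (starWeight V a b)) hDx
    have h2 : degZero _ (starWeight V a b) (gen (Unlinked V a b) .star 0) = 0 := by
      simp [degZero_gen, starWeight]
    have h3 : degZero _ (starWeight V a b) (gen (Unlinked V a b) (.vertex a) 0) =
        gen (Unlinked V a b) (.vertex a) 0 := by
      simp [degZero_gen, starWeight]
    rw [map_zero, map_add, map_add, map_smul, map_smul, map_mul, map_mul, map_mul, h2, zero_mul,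
      smul_zero, add_zero, h3, ← mul_smul_comm (_ ^ _), ← mul_add,
      gen_zero_mul_eq_zero_iff h.symm] at h1
    have h4 := congrArg (unlinkedProj hab) h1
    rw [unlinkedProj_shift, map_add, map_smul _ c, map_smul _ c, map_smul (unlinkedProj hab),
      unlinkedProj_degZero, unlinkedProj_degZero, unlinkedProj_diff hab hm, smul_zero, add_zero,
      map_mul, unlinkedProj_vertex, map_zero, map_smul, map_mul, shift_gen, if_pos le_rfl,
      Nat.sub_self,
      smul_eq_zero_iff_right (by rw [hc]; exact_mod_cast Nat.factorial_ne_zero _)] at h4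
    have h5 : gen V b 0 * shift V (fun i => M (.vertex a) (.vertex i)) 1
        (unlinkedProj hab v) = 0 := by
      rw [Pi.one_apply, one_smul] at h4
      exact h4
    rw [gen_zero_mul_eq_zero_iff hQ, shift_shift, mul_one] at h5
    rw [unlinkedProj_shift]
    refine Eq.trans ?_ h5
    congr 2
    ext i
    rw [Pi.add_apply, hM, incidenceMatrix_add_row hQ hab hm]
    by_cases hi : i = a <;> simp [ht, hM, hi]
  -- subtracting a boundary removes the component at `e_{star,0}`
  obtain ⟨w, hw, hwv⟩ := exists_diff_eq_of_mem_degPart h (leftWeight_eq_add hab)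
    (shift_mem_degPart t 1 hv) (ih _ (shift_mem_degPart t 1 hv) hcyc hproj)
  obtain ⟨w', hw', rfl⟩ := exists_shift_eq_of_mem_degPart t hw
  rw [diff_shift h htD (by simp), ht_split, ht_split, ← sub_eq_zero, ← map_sub, ← map_sub,
    ← gen_zero_mul_eq_zero_iff h.symm, map_sub, mul_sub, sub_eq_zero] at hwv
  set σ : ℚ := (-1) ^ M .star .star with hσ
  have hσσ : σ * σ = 1 := by rw [hσ, ← mul_pow]; simp
  have gs_mem := gen_mem_degPart (leftWeight V a b) .star 0
  rw [leftWeight_star] at gs_mem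
  have hz : shift (Unlinked V a b) (Pi.single (.vertex a) 1) 1
      (x - σ • diff h (gen (Unlinked V a b) .star 0 * w')) = 0 := by
    rw [hDs, map_sub, map_smul, map_add, map_mul, hga, zero_mul, zero_add, map_smul, map_mul, hgs,
      e₁, hwv, smul_smul, hσσ, one_smul, sub_self]
  have hxz : x - σ • diff h (gen (Unlinked V a b) .star 0 * w') ∈
      degPart (leftWeight V a b) (n + 1) :=
    sub_mem hx (Submodule.smul_mem _ _ (diff_mem_degPart h (leftWeight_eq_add hab)
      (add_comm 1 n ▸ mul_mem_degPart gs_mem hw')))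
  obtain ⟨u', hu', e'⟩ := exists_eq_gen_mul_of_mem_degPart leftWeight_left hxz hz
  obtain ⟨w'', hw''⟩ := exists_diff_eq_gen_mul hab h ih hu'
    (by rw [← e', map_sub, hD, map_smul, diff_diff, smul_zero, sub_zero])
    (by rw [← e', map_sub, hp, map_smul, unlinkedProj_diff hab hm, smul_zero, sub_zero])
  refine ⟨w'' + σ • (gen (Unlinked V a b) .star 0 * w'), ?_⟩
  rw [map_add, hw'', ← e', map_smul, sub_add_cancel]

include hQ hm in
/-- Homogeneous cycles over zero are boundaries: by induction on the degree and on the power of the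
shift of `a` and `star` that kills the cycle. -/
theorem exists_diff_eq_of_degPart (n : ℕ) (x : QAlg (Unlinked V a b))
    (hx : x ∈ degPart (leftWeight V a b) n) (hD : diff h x = 0) (hp : unlinkedProj hab x = 0) :
    ∃ w, diff h w = x := by
  induction n generalizing x with
  | zero =>
    obtain ⟨w, hw⟩ := exists_diff_eq_degZero hab h hp
    refine ⟨w, hw.trans ?_⟩
    rw [← degZero_eq_self hx, degZero, degZero, shift_shift, add_zero]
    congr 2
    ext i
    rcases i with i | _ <;> simp [starWeight, leftWeight_star]
  | succ n ih =>
    obtain ⟨k, hk⟩ := exists_iterate_shift_eq_zero (leftWeight V a b) x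
    rw [degZero_eq_zero (Nat.succ_ne_zero n) hx, sub_zero] at hk
    induction k generalizing x with
    | zero => exact ⟨0, by rw [map_zero]; exact hk.symm⟩
    | succ k ihk =>
      have hcomm := diff_shift h (leftWeight_eq_add (V := V) hab)
        (show (1 : Unlinked V a b → ℚ) .star = 1 * 1 by simp)
      have hsx := shift_mem_degPart (leftWeight V a b) 1 hx
      obtain ⟨y, hy, e⟩ := exists_diff_eq_of_mem_degPart h (leftWeight_eq_add hab) hsx
        (ihk _ hsx (by rw [hcomm, hD, map_zero]) (by rw [unlinkedProj_shift, hp, map_zero]) hk)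
      obtain ⟨y', hy', rfl⟩ := exists_shift_eq_of_mem_degPart (leftWeight V a b) hy
      obtain ⟨w, hw⟩ := exists_diff_eq_of_shift_eq_zero hQ hab hm h ih
        (sub_mem hx (diff_mem_degPart h (leftWeight_eq_add hab) hy'))
        (by rw [map_sub, hD, diff_diff, sub_zero])
        (by rw [map_sub, hp, unlinkedProj_diff hab hm, sub_zero])
        (by rw [map_sub, ← e, hcomm, sub_self])
      exact ⟨w + y', by rw [map_add, hw, sub_add_cancel]⟩

include hQ hm in
/-- A cycle that the projection to `A_Q` kills is a boundary. -/
theorem exists_diff_eq {x : QAlg (Unlinked V a b)} (hD : diff h x = 0)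
    (hp : unlinkedProj hab x = 0) : ∃ w, diff h w = x := by
  obtain ⟨S, g, hg, rfl⟩ := exists_degPart_decomposition (leftWeight V a b) x
  have h1 : ∀ n ∈ S, diff h (g n) = 0 := by
    rw [map_sum] at hD
    refine eq_zero_of_sum_eigen (shift _ 0 (fun j => 2 ^ leftWeight V a b j)).toLinearMap
      one_ne_zero S _ (fun n _ => ?_) hD
    rw [one_mul]
    exact mem_degPart.mp (diff_mem_degPart h (leftWeight_eq_add hab) (hg n))
  have h2 : ∀ n ∈ S, unlinkedProj hab (g n) = 0 := by
    rw [map_sum] at hp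
    refine eq_zero_of_sum_eigen
      (shift V 0 (fun j => 2 ^ leftWeight V a b (.vertex j))).toLinearMap
      one_ne_zero S _ (fun n _ => ?_) hp
    rw [one_mul, ← map_smul, ← mem_degPart.mp (hg n), unlinkedProj_shift]
    rfl
  choose! w hw using fun n hn => exists_diff_eq_of_degPart hQ hab hm h n (g n) (hg n) (h1 n hn)
    (h2 n hn)
  exact ⟨∑ n ∈ S, w n, by rw [map_sum]; exact Finset.sum_congr rfl hw⟩

end Acyclic

/-! ### The homology of the algebra of the unlinked quiver -/

section Homology

variable {V : Type u} [Quiver.{v} V] {a b : V}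

theorem isUnlinkingOnGenerators_diff
    (h : IsUnlinkingVertex (W := Unlinked V a b) (.vertex a) (.vertex b) .star) :
    IsUnlinkingOnGenerators V a b (diff h) where
  star k := by
    rw [diff_gen_self, ← incidenceMatrix_left_right (a := a) (b := b)]
    rfl
  vertex i k := diff_gen_of_ne h (by simp) k

/-- An odd derivation is determined by its values on the generators. -/
theorem IsOddDerivation.ext {D E : QAlg V →ₗ[ℚ] QAlg V} (hD : IsOddDerivation V D)
    (hE : IsOddDerivation V E) (hDE : ∀ i k, D (gen V i k) = E (gen V i k)) : D = E :=
  QAlg.skew_ext (L := parity V) (R := AlgHom.id ℚ _) hD.leibniz_parity hE.leibniz_parity hDE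

variable (hQ : IsSymmetric V) (hab : a ≠ b) (hm : 0 < incidenceMatrix V a b)
  (h : IsUnlinkingVertex (W := Unlinked V a b) (.vertex a) (.vertex b) .star)
include hm

theorem toHomology_injective : Function.Injective (toHomology hab h) := by
  rw [injective_iff_map_eq_zero]
  intro x hx
  obtain ⟨y, rfl⟩ := QAlg.hom_surjective (φ := unlinkedProj hab)
    (fun i k => ⟨_, unlinkedProj_vertex hab i k⟩) x
  rw [toHomology_unlinkedProj] at hx
  obtain ⟨w, hw⟩ := Ideal.Quotient.eq_zero_iff_mem.mp hx
  rw [← unlinkedProj_degZero]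
  exact (congrArg (unlinkedProj hab) hw).symm.trans (unlinkedProj_diff hab hm h w)

include hQ in
theorem toHomology_surjective [Finite V] : Function.Surjective (toHomology hab h) := by
  intro y
  obtain ⟨⟨x, hx⟩, rfl⟩ := Ideal.Quotient.mk_surjective y
  refine ⟨unlinkedProj hab x, ?_⟩
  rw [toHomology_unlinkedProj, homologyClass, eq_comm, Ideal.Quotient.eq]
  have hx' : diff h x = 0 := hx
  exact exists_diff_eq hQ hab hm h (x := x - degZero _ (starWeight V a b) x)
    (by rw [map_sub, hx', diff_degZero, sub_zero])
    (by rw [map_sub, unlinkedProj_degZero, sub_self])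

end Homology
end SymmQuiver

theorem mainTheorem2 {V : Type u} [Quiver.{v} V] [Finite V] [∀ i j : V, Finite (i ⟶ j)]
    (hQ : SymmQuiver.IsSymmetric V) (a b : V) (hab : a ≠ b)
    (hm : 0 < SymmQuiver.incidenceMatrix V a b) :
    ∃ (D : SymmQuiver.QAlg (SymmQuiver.Unlinked V a b) →ₗ[ℚ]
          SymmQuiver.QAlg (SymmQuiver.Unlinked V a b))
      (hD : SymmQuiver.IsOddDerivation (SymmQuiver.Unlinked V a b) D)
      (hgen : SymmQuiver.IsUnlinkingOnGenerators V a b D)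
      (hsq : ∀ x, D (D x) = 0),
      (∀ D' : SymmQuiver.QAlg (SymmQuiver.Unlinked V a b) →ₗ[ℚ]
          SymmQuiver.QAlg (SymmQuiver.Unlinked V a b),
        SymmQuiver.IsOddDerivation (SymmQuiver.Unlinked V a b) D' →
        SymmQuiver.IsUnlinkingOnGenerators V a b D' → D' = D) ∧
      ∃ Φ : SymmQuiver.Homology hD hsq ≃ₐ[ℚ] SymmQuiver.QAlg V,
        ∀ (i : V) (k : ℕ),
          Φ (SymmQuiver.homologyClass hD hsq (SymmQuiver.gen (SymmQuiver.Unlinked V a b)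
            (.vertex i) k) (hgen.vertex i k)) = SymmQuiver.gen V i k := by
  have h := SymmQuiver.isUnlinkingVertex_star hQ hab hm
  have hgen := SymmQuiver.isUnlinkingOnGenerators_diff h
  refine ⟨SymmQuiver.diff h, SymmQuiver.diff_isOddDerivation h, hgen, SymmQuiver.diff_diff h,
    fun D' hD' hgen' => hD'.ext (SymmQuiver.diff_isOddDerivation h) ?_,
    (AlgEquiv.ofBijective (SymmQuiver.toHomology hab h)
      ⟨SymmQuiver.toHomology_injective hab hm h,
        SymmQuiver.toHomology_surjective hQ hab hm h⟩).symm, fun i k => ?_⟩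
  · rintro (i | _) k
    · rw [hgen'.vertex, hgen.vertex]
    · rw [hgen'.star, hgen.star]
  · rw [AlgEquiv.symm_apply_eq]
    exact (SymmQuiver.toHomology_gen hab h i k).symm
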